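/- Let $M$ be a compact connected Riemann surface with a compatible Riemannian metric whose volume form $\mathrm{vol}_M$ satisfies $\int_M \mathrm{vol}_M=1$, and let $\sigma:M\to M$ be an anti-holomorphic involution which is an isometry. Let $(E,h)$ be a smooth Hermitian complex vector bundle of rank $r\ge 1$ and degree $d$ over $M$, where $d=\int_M \frac{i}{2\pi}\mathrm{tr}\,F_A$ for a unitary connection $A$ on $(E,h)$ with curvature $F_A=d_A\circ d_A$. Let $\widetilde\sigma$ be a real Hermitian structure on $(E,h)$, i.e. a smooth fibrewise $\mathbb{C}$-antilinear isometric involution of $E$ covering $\sigma$; it induces conjugations $s\mapsto\overline{s}$ and $\eta\mapsto\overline{\eta}$ on sections of $E$ and on $E$-valued forms by $\overline{s}(x)=\widetilde\sigma(s(\sigma(x)))$ and $\overline{\eta}_x(v)=\widetilde\sigma(\eta_{\sigma(x)}(d\sigma(v)))$. A smooth unitary connection $A$ on $(E,h)$ is called * Yang–Mills if $F_A=-2\pi i\,\frac dr\,\mathrm{Id}_E\,\mathrm{vol}_M$; * real if $d_A\overline{s}=\overline{d_As}$ for all smooth sections $s$ of $E$. Let $\mathcal{G}$ be the group of smooth unitary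 automorphisms of $(E,h)$ (the unitary gauge group), acting on unitary connections by $d_{u(A)}s=u(d_A(u^{-1}s))$, and let $\mathcal{G}^{\widetilde\sigma}\subset\mathcal{G}$ be the subgroup of those commuting with $\widetilde\sigma$ (the real gauge group). Let $\mathcal{M}^{r,d}_{(M,\sigma)}$ be the set of $\mathcal{G}$-orbits of Yang–Mills connections, which is the moduli space of semistable holomorphic bundles of rank $r$ and degree $d$: the orbit of $A$ is the point $[\mathrm{gr}(\mathcal{E})]$ for every semistable $\mathcal{E}$ whose associated graded bundle $\mathrm{gr}(\mathcal{E})$ (for a Jordan–Hölder filtration) is isomorphic to the holomorphic bundle $(E,d_A^{0,1})$. Let $$\mathcal{N}^{r,d}_{\sigma}=\{[\mathrm{gr}(\mathcal{E})]\in\mathcal{M}^{r,d}_{(M,\sigma)} : \mathcal{E}\text{ is semistable and real}\},$$ where a holomorphic bundle $\mathcal{E}$ is called real if it admits a real structure, i.e. a smooth fibrewise $\mathbb{C}$-antilinear involution covering $\sigma$ whose induced conjugations commute with its Dolbeault operator. Let $\mathcal{L}^{r,d}_{\widetilde\sigma}$ (the real quotient) be the set of $\mathcal{G}^{\widetilde\sigma}$-orbits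 of real Yang–Mills connections. Then sending the $\mathcal{G}^{\widetilde\sigma}$-orbit of a real Yang–Mills connection to its $\mathcal{G}$-orbit gives a well-defined map $\mathcal{L}^{r,d}_{\widetilde\sigma}\to\mathcal{N}^{r,d}_{\sigma}$, and this map is injective. -/

import Mathlib

open Bundle Set Filter Topology
open scoped Manifold ContDiff Bundle

noncomputable section

namespace RealYM

/-! ### Riemann surfaces as smooth real surfaces -/

section Surface

variable {M : Type*} [TopologicalSpace M] [ChartedSpace ℂ M]

/-- A Riemann surface is in particular a smooth real surface. -/
instance instRealManifold [IsManifold 𝓘(ℂ) ω M] : IsManifold 𝓘(ℝ, ℂ) ∞ M := by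
  apply isManifold_of_contDiffOn
  intro e e' he he'
  have h := ((contDiffGroupoid ω 𝓘(ℂ)).compatible he he')
  rw [contDiffGroupoid, mem_groupoid_of_pregroupoid] at h
  have h1 := h.1
  simp only [contDiffPregroupoid] at h1
  exact (h1.restrict_scalars ℝ).of_le (by exact le_top)

/-- The real tangent space of the surface at `x`. -/
abbrev Tan (x : M) : Type := TangentSpace 𝓘(ℝ, ℂ) x

/-- The complex structure of the surface: multiplication by `i` on a tangent space. -/
def J (x : M) : Tan x →ₗ[ℝ] Tan x := (LinearMap.mulLeft ℝ Complex.I : ℂ →ₗ[ℝ] ℂ)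

/-- The differential of a complex valued function, as a complex number. -/
def dfun (f : M → ℂ) (x : M) (v : Tan x) : ℂ := mfderiv 𝓘(ℝ, ℂ) 𝓘(ℝ, ℂ) f x v

variable (M) in
/-- Smooth vector fields. -/
abbrev VField [IsManifold 𝓘(ℂ) ω M] : Type _ :=
  Cₛ^∞⟮𝓘(ℝ, ℂ); ℂ, (fun x : M => TangentSpace 𝓘(ℝ, ℂ) x)⟯

lemma J_smooth [IsManifold 𝓘(ℂ) ω M] (X : VField M) :
    ContMDiff 𝓘(ℝ, ℂ) (𝓘(ℝ, ℂ).prod 𝓘(ℝ, ℂ)) ∞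
      (fun x => TotalSpace.mk' ℂ (E := fun x : M => TangentSpace 𝓘(ℝ, ℂ) x) x (J x (X x))) := by
  intro x₀
  have hX := X.contMDiff x₀
  rw [contMDiffAt_section] at hX ⊢
  have hI : ContMDiffAt 𝓘(ℝ, ℂ) 𝓘(ℝ, ℂ) ∞ (fun x => Complex.I *
      (trivializationAt ℂ (fun x : M => TangentSpace 𝓘(ℝ, ℂ) x) x₀ ⟨x, X x⟩).2) x₀ :=
    ContDiff.comp_contMDiffAt (g := fun z : ℂ => Complex.I * z) (by fun_prop) hX
  refine hI.congr_of_eventuallyEq ?_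
  filter_upwards [(chartAt ℂ x₀).open_source.mem_nhds (mem_chart_source ℂ x₀)] with y hy
  rw [TangentBundle.trivializationAt_apply, TangentBundle.trivializationAt_apply]
  have hy' : chartAt ℂ y y ∈ ((chartAt ℂ y).symm ≫ₕ chartAt ℂ x₀).source := by
    simp [hy]
  have h := (contDiffGroupoid ω 𝓘(ℂ)).compatible (chart_mem_atlas ℂ y) (chart_mem_atlas ℂ x₀)
  rw [contDiffGroupoid, mem_groupoid_of_pregroupoid] at h
  have h1 := h.1
  simp only [contDiffPregroupoid] at h1
  have h2 : DifferentiableAt ℂ (chartAt ℂ x₀ ∘ (chartAt ℂ y).symm) (chartAt ℂ y y) := by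
    have := h1.contDiffAt (x := chartAt ℂ y y) (by
      simpa using ((chartAt ℂ y).symm ≫ₕ chartAt ℂ x₀).open_source.mem_nhds hy')
    simpa [Function.comp_def] using this.differentiableAt (by simp)
  have h3 : fderiv ℝ (chartAt ℂ x₀ ∘ (chartAt ℂ y).symm) (chartAt ℂ y y)
      = (fderiv ℂ (chartAt ℂ x₀ ∘ (chartAt ℂ y).symm) (chartAt ℂ y y)).restrictScalars ℝ :=
    h2.fderiv_restrictScalars ℝ
  have h4 : ∀ v : ℂ, fderivWithin ℝ ((chartAt ℂ x₀).extend 𝓘(ℝ, ℂ) ∘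
      ((chartAt ℂ y).extend 𝓘(ℝ, ℂ)).symm) (range 𝓘(ℝ, ℂ)) ((chartAt ℂ y).extend 𝓘(ℝ, ℂ) y) v
      = fderiv ℂ (chartAt ℂ x₀ ∘ (chartAt ℂ y).symm) (chartAt ℂ y y) v := by
    intro v
    have := congrArg (fun L : ℂ →L[ℝ] ℂ => L v) h3
    simpa [fderivWithin_univ, Function.comp_def] using this
  refine (h4 _).trans (Eq.trans ?_ (congrArg (Complex.I * ·) (h4 _)).symm)
  exact (fderiv ℂ (chartAt ℂ x₀ ∘ (chartAt ℂ y).symm) (chartAt ℂ y y)).map_smul Complex.I (X y)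

/-- The vector field `J X`. -/
def VField.rotate [IsManifold 𝓘(ℂ) ω M] (X : VField M) : VField M :=
  ⟨fun x => J x (X x), J_smooth X⟩

section Integration

variable [IsManifold 𝓘(ℂ) ω M] [T2Space M] [CompactSpace M]

variable (M) in
/-- A smooth partition of unity on `M` subordinate to the holomorphic charts. -/
def chartPartition : SmoothPartitionOfUnity M 𝓘(ℝ, ℂ) M univ :=
  Classical.choose (SmoothPartitionOfUnity.exists_isSubordinate_chartAt_source 𝓘(ℝ, ℂ) M)

/-- The coefficient at `z` of a (complex valued) 2-form in the holomorphic chart centred at `c`,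
with respect to the positively oriented frame `∂/∂x, ∂/∂y`, where `z = x + i y`. -/
def formCoeff (η : ∀ x : M, Tan x → Tan x → ℂ) (c : M) (z : ℂ) : ℂ :=
  η ((chartAt ℂ c).symm z)
    (mfderiv 𝓘(ℝ, ℂ) 𝓘(ℝ, ℂ) (chartAt ℂ c).symm z (1 : ℂ))
    (mfderiv 𝓘(ℝ, ℂ) 𝓘(ℝ, ℂ) (chartAt ℂ c).symm z Complex.I)

/-- The integral over `M`, in its canonical orientation, of a complex valued 2-form. -/
def integralForm (η : ∀ x : M, Tan x → Tan x → ℂ) : ℂ :=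
  ∑ᶠ c : M, ∫ z in (chartAt ℂ c).target,
    (chartPartition M c ((chartAt ℂ c).symm z) : ℂ) * formCoeff η c z

end Integration

variable (M) in
/-- A Riemannian metric compatible with the complex structure of the Riemann surface. -/
structure CompatibleMetric [IsManifold 𝓘(ℂ) ω M] where
  toFun : ∀ x : M, Tan x →ₗ[ℝ] Tan x →ₗ[ℝ] ℝ
  symm : ∀ x v w, toFun x v w = toFun x w v
  pos : ∀ x v, v ≠ 0 → 0 < toFun x v v
  J_invariant : ∀ x v w, toFun x (J x v) (J x w) = toFun x v w
  smooth : ∀ X Y : VField M, ContMDiff 𝓘(ℝ, ℂ) 𝓘(ℝ, ℝ) ∞ (fun x => toFun x (X x) (Y x))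

/-- The volume form of a compatible metric: `vol (v, w) = g (J v, w)`, so that
`vol (v, J v) = g (v, v)`. -/
def CompatibleMetric.vol [IsManifold 𝓘(ℂ) ω M] (g : CompatibleMetric M)
    (x : M) (v w : Tan x) : ℝ := g.toFun x (J x v) w

/-- The metric is normalised to have total volume one. -/
def CompatibleMetric.UnitVolume [IsManifold 𝓘(ℂ) ω M] [T2Space M] [CompactSpace M]
    (g : CompatibleMetric M) : Prop :=
  integralForm (fun (x : M) v w => (g.vol x v w : ℂ)) = 1

variable (M) in
/-- Anti-holomorphic involutions of the Riemann surface. -/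
structure AntiholInvolution where
  toFun : M → M
  involutive : Function.Involutive toFun
  smooth : ContMDiff 𝓘(ℝ, ℂ) 𝓘(ℝ, ℂ) ∞ toFun
  antihol : ∀ (x : M) (v : Tan x),
    mfderiv 𝓘(ℝ, ℂ) 𝓘(ℝ, ℂ) toFun x (J x v) = - J (toFun x) (mfderiv 𝓘(ℝ, ℂ) 𝓘(ℝ, ℂ) toFun x v)

/-- The tangent map of the involution. -/
def AntiholInvolution.tangent (σ : AntiholInvolution M) (x : M) (v : Tan x) : Tan (σ.toFun x) :=
  mfderiv 𝓘(ℝ, ℂ) 𝓘(ℝ, ℂ) σ.toFun x v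

/-- The involution is an isometry of the metric. -/
def AntiholInvolution.IsIsometry [IsManifold 𝓘(ℂ) ω M] (σ : AntiholInvolution M)
    (g : CompatibleMetric M) : Prop :=
  ∀ (x : M) (v w : Tan x), g.toFun (σ.toFun x) (σ.tangent x v) (σ.tangent x w) = g.toFun x v w

end Surface

/-! ### Smooth complex vector bundles and their sections -/

section VectorBundle

variable {M : Type*} [TopologicalSpace M] [ChartedSpace ℂ M]
  {F : Type*} [NormedAddCommGroup F] [NormedSpace ℂ F]
  {E : M → Type*} [TopologicalSpace (TotalSpace F E)] [∀ x, TopologicalSpace (E x)]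
  [FiberBundle F E] [∀ x, AddCommGroup (E x)] [∀ x, Module ℂ (E x)]

/-- A complex vector bundle is in particular a real vector bundle. -/
instance instRealVectorBundle [VectorBundle ℂ F E] : VectorBundle ℝ F E where
  trivialization_linear' e _ := by
    have := VectorBundle.trivialization_linear' (R := ℂ) (F := F) (E := E) e
    refine ⟨fun b hb => ⟨(this.linear b hb).1, fun c x => ?_⟩⟩
    have := (this.linear b hb).2 (c : ℂ) x
    simpa using this
  continuousOn_coordChange' e e' he he' := by
    have h := VectorBundle.continuousOn_coordChange' (R := ℂ) (F := F) (E := E) e e'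
    have h3 : ∀ e : Trivialization F (π F E), [MemTrivializationAtlas e] → e.IsLinear ℝ := by
      intro e _
      have := VectorBundle.trivialization_linear' (R := ℂ) (F := F) (E := E) e
      refine ⟨fun b hb => ⟨(this.linear b hb).1, fun c x => ?_⟩⟩
      have := (this.linear b hb).2 (c : ℂ) x
      simpa using this
    have h4 := h3 e
    have h5 := h3 e'
    refine ((ContinuousLinearMap.restrictScalarsL ℂ F F ℝ ℝ).continuous.comp_continuousOn
      h).congr fun b hb => ?_
    have h1 : e.IsLinear ℂ := VectorBundle.trivialization_linear' e
    have h2 : e'.IsLinear ℂ := VectorBundle.trivialization_linear' e'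
    ext y
    exact (Trivialization.coordChangeL_apply (R := ℝ) e e' hb y).trans
      (Trivialization.coordChangeL_apply (R := ℂ) e e' hb y).symm

variable (F E) in
/-- Smooth sections of `E`, that is `Ω⁰(M; E)`. -/
abbrev Sec : Type _ := Cₛ^∞⟮𝓘(ℝ, ℂ); F, E⟯

/-- Smoothness of a section. -/
abbrev SmoothSec (F : Type*) [NormedAddCommGroup F] [NormedSpace ℂ F]
    {E : M → Type*} [TopologicalSpace (TotalSpace F E)] [∀ x, TopologicalSpace (E x)]
    [FiberBundle F E] (s : ∀ x, E x) : Prop :=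
  ContMDiff 𝓘(ℝ, ℂ) (𝓘(ℝ, ℂ).prod 𝓘(ℝ, F)) ∞ (fun x => TotalSpace.mk' F x (s x))

variable (M) in
/-- Smooth complex valued functions on `M`. -/
abbrev CFun : Type _ := C^∞⟮𝓘(ℝ, ℂ), M; 𝓘(ℝ, ℂ), ℂ⟯

/-- The product of a smooth complex valued function and a smooth section. -/
def fmul [VectorBundle ℂ F E] (f : CFun M) (s : Sec F E) : Sec F E :=
  ⟨fun x => f x • s x, by
    intro x₀
    have hs := s.contMDiff x₀
    rw [contMDiffAt_section] at hs ⊢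
    have hf := f.contMDiff x₀
    have hb : ContDiff ℝ ∞ (fun p : ℂ × F => p.1 • p.2) :=
      (isBoundedBilinearMap_smul (𝕜 := ℝ) (A := ℂ) (E := F)).contDiff
    refine (hb.comp_contMDiffAt (hf.prodMk_space hs)).congr_of_eventuallyEq ?_
    filter_upwards [(trivializationAt F E x₀).open_baseSet.mem_nhds
      (mem_baseSet_trivializationAt F E x₀)] with x hx
    exact ((trivializationAt F E x₀).linear ℂ hx).2 _ _⟩

end VectorBundle

/-! ### Hermitian metrics, connections, Dolbeault operators -/

section Hermitian

variable {M : Type*} [TopologicalSpace M] [ChartedSpace ℂ M] [IsManifold 𝓘(ℂ) ω M]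
  {F : Type*} [NormedAddCommGroup F] [NormedSpace ℂ F]
  {E : M → Type*} [TopologicalSpace (TotalSpace F E)] [∀ x, TopologicalSpace (E x)]
  [FiberBundle F E] [∀ x, AddCommGroup (E x)] [∀ x, Module ℂ (E x)]
  [VectorBundle ℂ F E]

variable (F E) in
/-- Smooth Hermitian metrics on `E` (antilinear in the first variable). -/
structure HermitianMetric where
  toFun : ∀ x, E x →ₗ⋆[ℂ] E x →ₗ[ℂ] ℂ
  conj_symm : ∀ x e e', starRingEnd ℂ (toFun x e e') = toFun x e' e
  pos : ∀ x e, e ≠ 0 → 0 < (toFun x e e).re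
  smooth : ∀ s t : Sec F E,
    ContMDiff 𝓘(ℝ, ℂ) 𝓘(ℝ, ℂ) ∞ (fun x => toFun x (s x) (t x))

/-- Unitary connections on `(E, h)`: operators `d_A : Ω⁰(M; E) → Ω¹(M; E)` satisfying the Leibniz
identity and compatible with `h`. The value of `d_A s` at `x` on the tangent vector `v` is
`A.toFun s x v`. -/
@[ext]
structure UnitaryConnection (h : HermitianMetric F E) where
  toFun : Sec F E → ∀ x : M, Tan x →ₗ[ℝ] E x
  smooth : ∀ (s : Sec F E) (X : VField M), SmoothSec F (fun x => toFun s x (X x))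
  add : ∀ (s t : Sec F E) (x : M), toFun (s + t) x = toFun s x + toFun t x
  leibniz : ∀ (f : CFun M) (s : Sec F E) (x : M) (v : Tan x),
    toFun (fmul f s) x v = dfun f x v • s x + f x • toFun s x v
  unitary : ∀ (s t : Sec F E) (x : M) (v : Tan x),
    dfun (fun y => h.toFun y (s y) (t y)) x v =
      h.toFun x (toFun s x v) (t x) + h.toFun x (s x) (toFun t x v)

/-- The `(0,1)`-part of the differential of a function: `∂̄f (v) = (df(v) + i df(Jv)) / 2`. -/
def dbarFun (f : M → ℂ) (x : M) (v : Tan x) : ℂ :=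
  (dfun f x v + Complex.I * dfun f x (J x v)) / 2

variable (F E) in
/-- Dolbeault operators on `E`, i.e. holomorphic structures on the smooth complex vector
bundle `E`: operators `D : Ω⁰(M; E) → Ω^{0,1}(M; E)` satisfying the Leibniz identity. -/
@[ext]
structure DolbeaultOperator where
  toFun : Sec F E → ∀ x : M, Tan x →ₗ[ℝ] E x
  antilinear : ∀ (s : Sec F E) (x : M) (v : Tan x), toFun s x (J x v) = -(Complex.I • toFun s x v)
  smooth : ∀ (s : Sec F E) (X : VField M), SmoothSec F (fun x => toFun s x (X x))
  add : ∀ (s t : Sec F E) (x : M), toFun (s + t) x = toFun s x + toFun t x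
  leibniz : ∀ (f : CFun M) (s : Sec F E) (x : M) (v : Tan x),
    toFun (fmul f s) x v = dbarFun f x v • s x + f x • toFun s x v

variable {h : HermitianMetric F E}

/-- The Dolbeault operator `d_A^{0,1}` of a unitary connection: the `(0,1)`-part
`(d_A s (v) + i d_A s (J v)) / 2` of the connection. -/
def UnitaryConnection.dolbeault (A : UnitaryConnection h) : DolbeaultOperator F E where
  toFun s x :=
    { toFun := fun v => (1 / 2 : ℂ) • (A.toFun s x v + Complex.I • A.toFun s x (J x v))
      map_add' := fun v w => by
        simp only [map_add, smul_add]; abel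
      map_smul' := fun c v => by
        simp only [map_smul, RingHom.id_apply, smul_add]
        rw [smul_comm Complex.I c, smul_comm (1 / 2 : ℂ) c, smul_comm (1 / 2 : ℂ) c] }
  antilinear s x v := by
    have hJ : J x (J x v) = -v := by
      have : ∀ z : ℂ, Complex.I * (Complex.I * z) = -z := fun z => by
        rw [← mul_assoc, Complex.I_mul_I]; simp
      exact this v
    simp only [LinearMap.coe_mk, AddHom.coe_mk, hJ, map_neg, smul_neg]
    match_scalars
    · linear_combination (1 / 2 : ℂ) * Complex.I_sq
    · ring
  smooth s X := by
    exact (fmul ⟨fun _ => (1 / 2 : ℂ), contMDiff_const⟩ (⟨_, A.smooth s X⟩ +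
      fmul ⟨fun _ => Complex.I, contMDiff_const⟩ ⟨_, A.smooth s X.rotate⟩) : Sec F E).contMDiff
  add s t x := by
    ext v
    simp only [A.add, LinearMap.add_apply, LinearMap.coe_mk, AddHom.coe_mk, smul_add]
    abel
  leibniz f s x v := by
    simp only [A.leibniz, LinearMap.coe_mk, AddHom.coe_mk, dbarFun]
    module

/-! ### Subbundles -/

/-- A smooth complex subbundle of rank `rank` of `E`, represented by the field of
`h`-orthogonal projections onto its fibres. -/
structure Subbundle (h : HermitianMetric F E) where
  proj : ∀ x, E x →ₗ[ℂ] E x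
  idem : ∀ x e, proj x (proj x e) = proj x e
  selfAdjoint : ∀ x e e', h.toFun x (proj x e) e' = h.toFun x e (proj x e')
  smooth : ∀ s : Sec F E, SmoothSec F (fun x => proj x (s x))
  rank : ℕ
  finrank_eq : ∀ x, Module.finrank ℂ (LinearMap.range (proj x)) = rank

/-- The orthogonal projection of a section to a subbundle. -/
def Subbundle.apply (P : Subbundle h) (s : Sec F E) : Sec F E := ⟨fun x => P.proj x (s x), P.smooth s⟩

/-- Inclusion of subbundles. -/
def Subbundle.Le (P Q : Subbundle h) : Prop :=
  ∀ x, LinearMap.range (P.proj x) ≤ LinearMap.range (Q.proj x)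

variable (h) in
/-- The whole bundle `E` as a subbundle of itself. -/
def Subbundle.whole : Subbundle h where
  proj _ := LinearMap.id
  idem _ _ := rfl
  selfAdjoint _ _ _ := rfl
  smooth s := s.contMDiff
  rank := Module.finrank ℂ F
  finrank_eq x := by
    rw [LinearMap.range_id, finrank_top]
    exact ((trivializationAt F E x).continuousLinearEquivAt ℂ x
      (mem_baseSet_trivializationAt F E x)).toLinearEquiv.finrank_eq

/-- The covariant derivative, along a vector field `X`, induced by `A` on the subbundle `P`:
`s ↦ P (d_A (P s) (X))`. -/
def UnitaryConnection.covOn (A : UnitaryConnection h) (P : Subbundle h) (X : VField M)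
    (s : Sec F E) : Sec F E :=
  P.apply ⟨fun x => A.toFun (P.apply s) x (X x), A.smooth (P.apply s) X⟩

/-- `R` is the curvature 2-form of the connection induced by `A` on the subbundle `P` (extended by
zero to the orthogonal complement of `P`):
`R(X, Y) s = ∇_X ∇_Y s - ∇_Y ∇_X s - ∇_{[X, Y]} s`. -/
def UnitaryConnection.IsCurvatureOn (A : UnitaryConnection h) (P : Subbundle h)
    (R : ∀ x : M, Tan x → Tan x → E x →ₗ[ℂ] E x) : Prop :=
  ∀ (X Y : VField M) (s : Sec F E) (x : M),
    R x (X x) (Y x) (s x) = A.covOn P X (A.covOn P Y s) x - A.covOn P Y (A.covOn P X s) x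
      - P.proj x (A.toFun (P.apply s) x (VectorField.mlieBracket 𝓘(ℝ, ℂ) X Y x))

/-- `R` is the curvature `F_A = d_A ∘ d_A` of `A`. -/
def UnitaryConnection.IsCurvature (A : UnitaryConnection h)
    (R : ∀ x : M, Tan x → Tan x → E x →ₗ[ℂ] E x) : Prop :=
  A.IsCurvatureOn (Subbundle.whole h) R

/-! ### Gauge groups -/

variable (F E) in
/-- The group `Aut(E)` of smooth complex linear automorphisms of `E` (complex gauge group). -/
def complexGauge : Subgroup (∀ x, E x ≃ₗ[ℂ] E x) where
  carrier := {u | (∀ s : Sec F E, SmoothSec F (fun x => u x (s x))) ∧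
    ∀ s : Sec F E, SmoothSec F (fun x => (u x).symm (s x))}
  mul_mem' hu hv := ⟨fun s => hu.1 ⟨_, hv.1 s⟩, fun s => hv.2 ⟨_, hu.2 s⟩⟩
  one_mem' := ⟨fun s => s.contMDiff, fun s => s.contMDiff⟩
  inv_mem' hu := ⟨hu.2, hu.1⟩

variable (h) in
/-- The unitary gauge group of `(E, h)`. -/
def unitaryGauge : Subgroup (∀ x, E x ≃ₗ[ℂ] E x) where
  carrier := {u | u ∈ complexGauge F E ∧ ∀ x e e', h.toFun x (u x e) (u x e') = h.toFun x e e'}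
  mul_mem' hu hv := ⟨mul_mem hu.1 hv.1, fun x e e' => (hu.2 x _ _).trans (hv.2 x e e')⟩
  one_mem' := ⟨one_mem _, fun _ _ _ => rfl⟩
  inv_mem' {u} hu := ⟨inv_mem hu.1, fun x e e' => by
    have := hu.2 x ((u x).symm e) ((u x).symm e')
    simpa using this.symm⟩

/-- The action of an automorphism on sections. -/
def gaugeSec (u : complexGauge F E) (s : Sec F E) : Sec F E := ⟨fun x => u.1 x (s x), u.2.1 s⟩

/-- A unitary automorphism as an automorphism. -/
def toComplexGauge (u : unitaryGauge h) : complexGauge F E := ⟨u.1, u.2.1⟩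

/-- The gauge action `d_{u(A)} s = u (d_A (u⁻¹ s))` of the unitary gauge group on the space of
unitary connections. -/
instance instGaugeAction : MulAction (unitaryGauge h) (UnitaryConnection h) where
  smul u A :=
    { toFun := fun s x => ((u.1 x).toLinearMap.restrictScalars ℝ) ∘ₗ
        A.toFun (gaugeSec (toComplexGauge u)⁻¹ s) x
      smooth := fun s X => u.2.1.1 ⟨_, A.smooth (gaugeSec (toComplexGauge u)⁻¹ s) X⟩
      add := fun s t x => by
        have : gaugeSec (toComplexGauge u)⁻¹ (s + t) = gaugeSec (toComplexGauge u)⁻¹ s +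
            gaugeSec (toComplexGauge u)⁻¹ t := by
          ext y; exact map_add ((u.1 y).symm) (s y) (t y)
        rw [this, A.add, LinearMap.comp_add]
      leibniz := fun f s x v => by
        have : gaugeSec (toComplexGauge u)⁻¹ (fmul f s) =
            fmul f (gaugeSec (toComplexGauge u)⁻¹ s) := by
          ext y; exact map_smul ((u.1 y).symm) (f y) (s y)
        have h2 : u.1 x (gaugeSec (toComplexGauge u)⁻¹ s x) = s x :=
          (u.1 x).apply_symm_apply (s x)
        simp [this, A.leibniz, h2]
      unitary := fun s t x v => by
        have h1 : ∀ (s : Sec F E) y, u.1 y (gaugeSec (toComplexGauge u)⁻¹ s y) = s y :=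
          fun s y => (u.1 y).apply_symm_apply (s y)
        have h2 : ∀ y, h.toFun y (gaugeSec (toComplexGauge u)⁻¹ s y)
            (gaugeSec (toComplexGauge u)⁻¹ t y) = h.toFun y (s y) (t y) := fun y => by
          rw [← u.2.2 y, h1, h1]
        have h3 := A.unitary (gaugeSec (toComplexGauge u)⁻¹ s)
          (gaugeSec (toComplexGauge u)⁻¹ t) x v
        simp only [h2] at h3
        rw [h3, ← u.2.2 x, ← u.2.2 x (gaugeSec (toComplexGauge u)⁻¹ s x), h1, h1]
        rfl }
  one_smul A := rfl
  mul_smul u v A := rfl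

/-! ### Real structures -/

variable (F E) in
/-- Smooth real structures on `E` covering `σ`: fibrewise `ℂ`-antilinear involutions of the total
space covering `σ`. -/
structure RealStructure (σ : AntiholInvolution M) where
  toFun : ∀ x, E x →ₗ⋆[ℂ] E (σ.toFun x)
  involutive : ∀ x e, TotalSpace.mk' F (σ.toFun (σ.toFun x)) (toFun (σ.toFun x) (toFun x e)) =
    TotalSpace.mk' F x e
  smooth : ContMDiff (𝓘(ℝ, ℂ).prod 𝓘(ℝ, F)) (𝓘(ℝ, ℂ).prod 𝓘(ℝ, F)) ∞
    (fun p : TotalSpace F E => TotalSpace.mk' F (σ.toFun p.1) (toFun p.1 p.2))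

variable {σ : AntiholInvolution M}

/-- The real structure is Hermitian, i.e. an (antilinear) isometry of `(E, h)`. -/
def RealStructure.IsHermitian (τ : RealStructure F E σ) (h : HermitianMetric F E) : Prop :=
  ∀ x e e', h.toFun (σ.toFun x) (τ.toFun x e) (τ.toFun x e') = starRingEnd ℂ (h.toFun x e e')

/-- The real structure `s ↦ s̄` on sections, where `s̄(x)` is the conjugate of `s(σ(x))`. -/
def RealStructure.conjSec (τ : RealStructure F E σ) (s : Sec F E) : Sec F E :=
  ⟨fun x => σ.involutive x ▸ τ.toFun (σ.toFun x) (s (σ.toFun x)), by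
    have h1 : ContMDiff 𝓘(ℝ, ℂ) (𝓘(ℝ, ℂ).prod 𝓘(ℝ, F)) ∞ (fun x =>
        TotalSpace.mk' F (σ.toFun (σ.toFun x)) (τ.toFun (σ.toFun x) (s (σ.toFun x)))) :=
      τ.smooth.comp (s.contMDiff.comp σ.smooth)
    have h2 : ∀ (x y : M) (hxy : y = x) (e : E y),
        TotalSpace.mk' F x (hxy ▸ e) = TotalSpace.mk' F y e := by
      rintro x _ rfl e; rfl
    exact h1.congr fun x => h2 _ _ _ _⟩

/-- A unitary connection is real if it commutes with the real structures of `Ω⁰(M; E)` and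
`Ω¹(M; E)`: `d_A s̄` is the conjugate of `d_A s`, i.e. `(d_A s̄)(dσ(v)) = τ (d_A s (v))`. -/
def UnitaryConnection.IsReal (A : UnitaryConnection h) (τ : RealStructure F E σ) : Prop :=
  ∀ (s : Sec F E) (x : M) (v : Tan x),
    A.toFun (τ.conjSec s) (σ.toFun x) (σ.tangent x v) = τ.toFun x (A.toFun s x v)

/-- A Dolbeault operator is real if it commutes with the real structures. -/
def DolbeaultOperator.IsReal (D : DolbeaultOperator F E) (τ : RealStructure F E σ) : Prop :=
  ∀ (s : Sec F E) (x : M) (v : Tan x),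
    D.toFun (τ.conjSec s) (σ.toFun x) (σ.tangent x v) = τ.toFun x (D.toFun s x v)

variable (h) in
/-- The real gauge group: unitary automorphisms of `(E, h)` commuting with the real structure. -/
def realGauge (τ : RealStructure F E σ) : Subgroup (unitaryGauge h) where
  carrier := {u | ∀ x e, u.1 (σ.toFun x) (τ.toFun x e) = τ.toFun x (u.1 x e)}
  mul_mem' {u v} hu hv := fun x e => by
    have h1 := hu x (v.1 x e)
    have h2 := hv x e
    change u.1 _ (v.1 _ _) = τ.toFun x (u.1 x (v.1 x e))
    rw [h2, h1]
  one_mem' := fun _ _ => rfl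
  inv_mem' {u} hu := fun x e => by
    change (u.1 _).symm _ = τ.toFun x ((u.1 x).symm e)
    rw [LinearEquiv.symm_apply_eq, hu, LinearEquiv.apply_symm_apply]

/-! ### Degree, stability, Jordan-Hölder filtrations -/

/-- `P` is a holomorphic subbundle of `(E, D)`. -/
def DolbeaultOperator.IsHolomorphicSubbundle (D : DolbeaultOperator F E) (P : Subbundle h) : Prop :=
  ∀ (s : Sec F E) (x : M) (v : Tan x),
    P.proj x (D.toFun (P.apply s) x v) = D.toFun (P.apply s) x v

section Degree

variable [T2Space M] [CompactSpace M]

variable (h) in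
/-- `E` has degree `δ`: `δ` is the integral of the first Chern form `(i / 2π) tr F_A` of a unitary
connection. -/
def HasDegree (δ : ℝ) : Prop :=
  ∃ (A : UnitaryConnection h) (R : ∀ x : M, Tan x → Tan x → E x →ₗ[ℂ] E x), A.IsCurvature R ∧
    (δ : ℂ) = Complex.I / (2 * Real.pi) *
      integralForm (fun x v w => LinearMap.trace ℂ (E x) (R x v w))

/-- The holomorphic subbundle `P` of `(E, D)` has degree `δ`: `δ` is the integral of the first Chern
form of the connection induced on `P` by the Chern connection `A` of `(E, D, h)`, which is the
unitary connection with `d_A^{0,1} = D`. -/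
def DolbeaultOperator.SubbundleDegree (D : DolbeaultOperator F E) (P : Subbundle h) (δ : ℝ) :
    Prop :=
  ∃ (A : UnitaryConnection h) (R : ∀ x : M, Tan x → Tan x → E x →ₗ[ℂ] E x),
    A.dolbeault = D ∧ A.IsCurvatureOn P R ∧
    (δ : ℂ) = Complex.I / (2 * Real.pi) *
      integralForm (fun x v w => LinearMap.trace ℂ (E x) (R x v w))

variable (h) in
/-- The holomorphic bundle `(E, D)` is semistable: `μ(P) ≤ μ(E)` for all holomorphic subbundles `P`
which are neither `0` nor `E`. -/
def DolbeaultOperator.IsSemistable (D : DolbeaultOperator F E) : Prop :=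
  ∀ P : Subbundle h, D.IsHolomorphicSubbundle P → 0 < P.rank → P.rank < Module.finrank ℂ F →
    ∀ δ δE : ℝ, D.SubbundleDegree P δ → D.SubbundleDegree (Subbundle.whole h) δE →
      δ / P.rank ≤ δE / Module.finrank ℂ F

/-- For holomorphic subbundles `P ⊂ Q` of `(E, D)`, the quotient bundle `Q / P` is stable (and
non-zero). The holomorphic subbundles of `Q / P` are the `H / P` with `P ⊂ H ⊂ Q`. -/
def DolbeaultOperator.IsStableQuotient (D : DolbeaultOperator F E) (P Q : Subbundle h) : Prop :=
  P.rank < Q.rank ∧ ∀ H : Subbundle h, D.IsHolomorphicSubbundle H → P.Le H → H.Le Q →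
    P.rank < H.rank → H.rank < Q.rank →
    ∀ δP δH δQ : ℝ, D.SubbundleDegree P δP → D.SubbundleDegree H δH → D.SubbundleDegree Q δQ →
      (δH - δP) / ((H.rank : ℝ) - P.rank) < (δQ - δP) / ((Q.rank : ℝ) - P.rank)

/-- For holomorphic subbundles `P ⊂ Q` of `(E, D)`, the quotient `Q / P` has the slope of `E`. -/
def DolbeaultOperator.QuotientHasSlope (D : DolbeaultOperator F E) (P Q : Subbundle h) : Prop :=
  ∀ δP δQ δE : ℝ, D.SubbundleDegree P δP → D.SubbundleDegree Q δQ →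
    D.SubbundleDegree (Subbundle.whole h) δE →
      (δQ - δP) / ((Q.rank : ℝ) - P.rank) = δE / Module.finrank ℂ F

/-- `P 0 ⊂ P 1 ⊂ ⋯ ⊂ P n` is a Jordan-Hölder filtration of the holomorphic bundle `(E, D)`: a
filtration from `0` to `E` by holomorphic subbundles, whose successive quotients are stable and have
the slope of `E`. -/
structure DolbeaultOperator.IsJordanHolder (D : DolbeaultOperator F E) (n : ℕ)
    (P : ℕ → Subbundle h) : Prop where
  holomorphic : ∀ i ≤ n, D.IsHolomorphicSubbundle (P i)
  bot : (P 0).rank = 0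
  top : (P n).rank = Module.finrank ℂ F
  le : ∀ i < n, (P i).Le (P (i + 1))
  stable : ∀ i < n, D.IsStableQuotient (P i) (P (i + 1))
  slope : ∀ i < n, D.QuotientHasSlope (P i) (P (i + 1))

end Degree

/-- The component of a section in `P (i + 1) ⊖ P i`, which is identified with the smooth bundle
`P (i + 1) / P i`. -/
def gradedPart (P : ℕ → Subbundle h) (i : ℕ) (s : Sec F E) : Sec F E :=
  (P (i + 1)).apply s - (P i).apply s

/-- The Dolbeault operator of the graded bundle `⨁ P (i + 1) / P i` associated to a filtration of
`(E, D)` by holomorphic subbundles, transported to `E` by the smooth isomorphism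
`E = ⨁ (P (i + 1) ⊖ P i)`. -/
def DolbeaultOperator.graded (D : DolbeaultOperator F E) (n : ℕ) (P : ℕ → Subbundle h)
    (s : Sec F E) (x : M) (v : Tan x) : E x :=
  ∑ i ∈ Finset.range n,
    ((P (i + 1)).proj x (D.toFun (gradedPart P i s) x v) -
      (P i).proj x (D.toFun (gradedPart P i s) x v))

/-- The graded bundle of a filtration of `(E, D)` is isomorphic to the holomorphic bundle
`(E, D')`. -/
def DolbeaultOperator.GradedIso (D : DolbeaultOperator F E) (n : ℕ) (P : ℕ → Subbundle h)
    (D' : DolbeaultOperator F E) : Prop :=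
  ∃ u : complexGauge F E, ∀ (s : Sec F E) (x : M) (v : Tan x),
    D'.toFun (gaugeSec u s) x v = u.1 x (D.graded n P s x v)

/-! ### Yang-Mills connections, moduli and the real quotient -/

/-- The curvature equation `F_A = - 2 π i (d / r) Id_E vol_M`, i.e. `* F_A = - 2 π i (d / r) Id_E`,
where `r` is the rank of `E`. -/
def UnitaryConnection.IsYangMills (A : UnitaryConnection h) (g : CompatibleMetric M) (d : ℤ) :
    Prop :=
  A.IsCurvature (fun x v w =>
    (-(2 * Real.pi * Complex.I * ((d : ℂ) / Module.finrank ℂ F)) * (g.vol x v w : ℂ)) •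
      LinearMap.id)

variable (h) in
/-- Yang-Mills connections. -/
abbrev YangMills (g : CompatibleMetric M) (d : ℤ) : Type _ :=
  {A : UnitaryConnection h // A.IsYangMills g d}

variable (h) in
/-- Two Yang-Mills connections are equivalent if they lie in the same unitary gauge orbit. -/
def unitaryOrbits (g : CompatibleMetric M) (d : ℤ) : Setoid (YangMills h g d) :=
  (MulAction.orbitRel (unitaryGauge h) (UnitaryConnection h)).comap Subtype.val

variable (h) in
/-- The moduli space of semistable bundles, presented as the set of unitary gauge orbits of
Yang-Mills connections. -/
abbrev Moduli (g : CompatibleMetric M) (d : ℤ) : Type _ := Quotient (unitaryOrbits h g d)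

variable (h) in
/-- The set of moduli of real semistable bundles. The unitary gauge orbit of the Yang-Mills
connection `A` is the point `[gr(ℰ)]` of the moduli space for all semistable `ℰ` such that `gr(ℰ)` is
isomorphic to `(E, d_A^{0,1})`. -/
def RealModuli [T2Space M] [CompactSpace M] (σ : AntiholInvolution M) (g : CompatibleMetric M)
    (d : ℤ) : Set (Moduli h g d) :=
  {q | ∃ A : YangMills h g d, q = Quotient.mk (unitaryOrbits h g d) A ∧
    ∃ D : DolbeaultOperator F E, D.IsSemistable h ∧ (∃ τ : RealStructure F E σ, D.IsReal τ) ∧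
      ∃ (n : ℕ) (P : ℕ → Subbundle h), D.IsJordanHolder n P ∧ D.GradedIso n P A.1.dolbeault}

variable (h) in
/-- Real Yang-Mills connections. -/
abbrev RealYangMills (g : CompatibleMetric M) (d : ℤ) (τ : RealStructure F E σ) : Type _ :=
  {A : YangMills h g d // A.1.IsReal τ}

variable (h) in
/-- Two real Yang-Mills connections are equivalent if they lie in the same real gauge orbit. -/
def realOrbits (g : CompatibleMetric M) (d : ℤ) (τ : RealStructure F E σ) :
    Setoid (RealYangMills h g d τ) :=
  (MulAction.orbitRel (realGauge h τ) (UnitaryConnection h)).comap (fun A => A.1.1)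

variable (h) in
/-- The real quotient: real Yang-Mills connections modulo the real gauge group. -/
abbrev RealQuotient (g : CompatibleMetric M) (d : ℤ) (τ : RealStructure F E σ) : Type _ :=
  Quotient (realOrbits h g d τ)

end Hermitian

end RealYM

end

open RealYM

/-!
The theorem has two halves.

**The map is well defined.** Let `A` be a real Yang-Mills connection and `D = d_A^{0,1}`. Reality of
`A` makes `D` real, so it suffices that `D` is semistable with a Jordan-Hölder filtration whose
graded bundle is `D` itself. If `P` is a holomorphic subbundle of `(E, D)` with second fundamental
form `B`, the Gauss equation gives `tr R_P(v, Jv) = κ(v, Jv) rank P + 2i |B v|²`, where `κ` is the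
scalar curvature form of `A` (`UnitaryConnection.hermitian_curvatureOn`). Integrating,
`deg P = rank P * d / r - (1/π) ∫ |B|²`, so `P` has at most the slope of `E`, with equality exactly
when `P` is parallel (`degree_of_yangMills`). This is semistability, and it shows that a maximal
filtration by parallel subbundles is a Jordan-Hölder filtration
(`exists_jordanHolder_of_yangMills`). Since parallel subbundles commute with `D`, the graded
Dolbeault operator of that filtration is `D` (`graded_eq_of_parallel`). The Chern connection of a
Dolbeault operator is unique (`UnitaryConnection.dolbeault_injective`), so degrees may be computed
with `A`; that the coefficients of the forms involved are continuous is needed for the integrals to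
be additive and for a nonnegative form with zero integral to vanish.

**The map is injective.** Let `A = u A'` with `A`, `A'` real and `u` unitary, and let
`ū = τ⁻¹ u τ`. Then `A = ū A'` too, so `φ = u⁻¹ ū` stabilizes `A'`, that is, `φ` is parallel; moreover
`φ τ = τ φ⁻¹`. Choose a polynomial `p` with `p(λ)² = λ` on the spectrum of `φ` at one point. A parallel
endomorphism `ψ` with parallel adjoint which vanishes at one point vanishes identically, because
`tr (ψ* ψ)` has zero differential (`UnitaryConnection.IsParallel.eq_zero`). Therefore `v = p(φ)` is a
unitary square root of `φ` everywhere, and it stabilizes `A'` (`exists_sqrt_stabilizer`). Its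
adjoint is `p̄(φ⁻¹)`, whence `v τ = τ v⁻¹`, and `w = u v` satisfies `w A' = A` and `w τ = τ w`
(`exists_real_gauge`).
-/

noncomputable section

set_option linter.unusedSectionVars false

namespace RealYM

/-! ### Extension of local sections and functions -/

section Extension

variable {M : Type*} [TopologicalSpace M] [T2Space M] [CompactSpace M] [ChartedSpace ℂ M]
  [IsManifold 𝓘(ℂ) ω M]

lemma exists_bump {U : Set M} (hU : IsOpen U) {x : M} (hx : x ∈ U) :
    ∃ χ : C^∞⟮𝓘(ℝ, ℂ), M; 𝓘(ℝ), ℝ⟯, (∀ᶠ y in 𝓝 x, χ y = 1) ∧ tsupport χ ⊆ U := by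
  obtain ⟨χ, h0, h1, -⟩ := exists_contMDiffMap_zero_one_nhds_of_isClosed 𝓘(ℝ, ℂ) (n := ⊤)
    hU.isClosed_compl (isClosed_singleton (x := x)) (by simpa using hx)
  refine ⟨χ, by simpa using h1, fun y hy => ?_⟩
  by_contra hyU
  have := h0.filter_mono (nhds_le_nhdsSet hyU)
  exact (notMem_tsupport_iff_eventuallyEq.2 this) hy

section Bundle

variable {F : Type*} [NormedAddCommGroup F] [NormedSpace ℝ F]
  {V : M → Type*} [TopologicalSpace (TotalSpace F V)] [∀ x, TopologicalSpace (V x)]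
  [FiberBundle F V] [∀ x, AddCommGroup (V x)] [∀ x, Module ℝ (V x)]
  [VectorBundle ℝ F V]

/-- The germ of a smooth local section extends to a global smooth section. -/
lemma exists_section_eventuallyEq {U : Set M} (hU : IsOpen U) {x : M} (hx : x ∈ U)
    {s : ∀ y, V y} (hs : ContMDiffOn 𝓘(ℝ, ℂ) (𝓘(ℝ, ℂ).prod 𝓘(ℝ, F)) ∞
      (fun y => TotalSpace.mk' F y (s y)) U) :
    ∃ t : Cₛ^∞⟮𝓘(ℝ, ℂ); F, V⟯, ∀ᶠ y in 𝓝 x, t y = s y := by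
  obtain ⟨χ, h1, h2⟩ := exists_bump hU hx
  refine ⟨⟨_, ContMDiffOn.smul_section_of_tsupport χ.contMDiff.contMDiffOn hU h2 hs⟩, ?_⟩
  filter_upwards [h1] with y hy
  change χ y • s y = s y
  rw [hy, one_smul]

/-- A vector of the model fibre, transported by a trivialization, extends to a global section
agreeing with the transported vector near any given point of the base set. -/
lemma exists_section_eventuallyEq_symm [ContMDiffVectorBundle ∞ F V 𝓘(ℝ, ℂ)] (c : M) {x : M}
    (hx : x ∈ (trivializationAt F V c).baseSet) (w : F) :
    ∃ t : Cₛ^∞⟮𝓘(ℝ, ℂ); F, V⟯, ∀ᶠ y in 𝓝 x, t y = (trivializationAt F V c).symm y w := by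
  refine exists_section_eventuallyEq (trivializationAt F V c).open_baseSet hx ?_
  rw [(trivializationAt F V c).contMDiffOn_section_baseSet_iff]
  refine (contMDiffOn_const (c := w)).congr fun y hy => ?_
  exact congrArg Prod.snd ((trivializationAt F V c).apply_mk_symm hy w)

lemma exists_section_apply_eq [ContMDiffVectorBundle ∞ F V 𝓘(ℝ, ℂ)] (x : M) (e : V x) :
    ∃ t : Cₛ^∞⟮𝓘(ℝ, ℂ); F, V⟯, t x = e := by
  have hx := mem_baseSet_trivializationAt F V x
  obtain ⟨t, ht⟩ := exists_section_eventuallyEq_symm x hx (trivializationAt F V x ⟨x, e⟩).2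
  exact ⟨t, ht.self_of_nhds.trans ((trivializationAt F V x).symm_apply_apply_mk hx e)⟩

end Bundle

/-- The germ of a smooth complex valued function extends to a global smooth function. -/
lemma exists_cfun_eventuallyEq {U : Set M} (hU : IsOpen U) {x : M} (hx : x ∈ U)
    {f : M → ℂ} (hf : ContMDiffOn 𝓘(ℝ, ℂ) 𝓘(ℝ, ℂ) ∞ f U) :
    ∃ k : CFun M, ∀ᶠ y in 𝓝 x, k y = f y := by
  obtain ⟨χ, h1, h2⟩ := exists_bump hU hx
  refine ⟨⟨fun y => χ y • f y, contMDiff_of_tsupport fun y hy => ?_⟩, ?_⟩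
  · have hyU := h2 (tsupport_smul_subset_left _ _ hy)
    exact (χ.contMDiff y).smul (hf.contMDiffAt (hU.mem_nhds hyU))
  · filter_upwards [h1] with y hy
    change χ y • f y = f y
    rw [hy, one_smul]

lemma dfun_eq_zero_of_eventuallyEq_const {f : M → ℂ} {x : M} {a : ℂ} (hf : ∀ᶠ y in 𝓝 x, f y = a)
    (v : Tan x) : dfun f x v = 0 := by
  have h : f =ᶠ[𝓝 x] fun _ => a := hf
  rw [dfun, h.mfderiv_eq, mfderiv_const]
  rfl

lemma dfun_congr {f k : M → ℂ} {x : M} (hf : f =ᶠ[𝓝 x] k) (v : Tan x) :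
    dfun f x v = dfun k x v := by
  rw [dfun, dfun, hf.mfderiv_eq]
  rfl

end Extension

/-! ### Local frames and locality of connections -/

section Complex

variable {M : Type*} [TopologicalSpace M] [T2Space M] [CompactSpace M] [ChartedSpace ℂ M]
  [IsManifold 𝓘(ℂ) ω M]
  {F : Type*} [NormedAddCommGroup F] [NormedSpace ℂ F]
  {E : M → Type*} [TopologicalSpace (TotalSpace F E)] [∀ x, TopologicalSpace (E x)]
  [FiberBundle F E] [∀ x, AddCommGroup (E x)] [∀ x, Module ℂ (E x)]
  [VectorBundle ℂ F E]

lemma exists_sec_apply_eq [ContMDiffVectorBundle ∞ F E 𝓘(ℝ, ℂ)] (x : M) (e : E x) :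
    ∃ s : Sec F E, s x = e := exists_section_apply_eq x e

lemma exists_vfield_apply_eq (x : M) (v : Tan x) : ∃ X : VField M, X x = v :=
  exists_section_apply_eq (V := fun x : M => TangentSpace 𝓘(ℝ, ℂ) x) x v

lemma finiteDimensional_fiber [FiniteDimensional ℂ F] (x : M) : FiniteDimensional ℂ (E x) :=
  ((trivializationAt F E x).continuousLinearEquivAt ℂ x
    (mem_baseSet_trivializationAt F E x)).symm.toLinearEquiv.finiteDimensional

/-- A smooth local frame of `E` near a point, by global sections, with the smooth coefficient
functions of sections in that frame. -/
lemma exists_local_frame [FiniteDimensional ℂ F] [ContMDiffVectorBundle ∞ F E 𝓘(ℝ, ℂ)] (x₀ : M) :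
    ∃ e : Fin (Module.finrank ℂ F) → Sec F E,
      (∀ᶠ y in 𝓝 x₀, ∃ β : Module.Basis (Fin (Module.finrank ℂ F)) ℂ (E y), ∀ i, β i = e i y) ∧
      ∀ t : Sec F E, ∃ a : Fin (Module.finrank ℂ F) → CFun M,
        ∀ᶠ y in 𝓝 x₀, t y = ∑ i, a i y • e i y := by
  set T := trivializationAt F E x₀
  have hx : x₀ ∈ T.baseSet := mem_baseSet_trivializationAt F E x₀
  let b := Module.finBasis ℂ F
  choose e he using fun i => exists_section_eventuallyEq_symm (V := E) x₀ hx (b i)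
  have he' : ∀ᶠ y in 𝓝 x₀, ∀ i, e i y = T.symm y (b i) := eventually_all.2 he
  have hb : ∀ y, ∀ hy : y ∈ T.baseSet, ∀ i,
      (b.map (T.continuousLinearEquivAt ℂ y hy).symm.toLinearEquiv) i = T.symm y (b i) := by
    intro y hy i
    simp
  refine ⟨e, ?_, fun t => ?_⟩
  · filter_upwards [he', T.open_baseSet.mem_nhds hx] with y hy hyT
    exact ⟨b.map (T.continuousLinearEquivAt ℂ y hyT).symm.toLinearEquiv, fun i =>
      (hb y hyT i).trans (hy i).symm⟩
  · have ht : ContMDiffOn 𝓘(ℝ, ℂ) 𝓘(ℝ, F) ∞ (fun y => (T ⟨y, t y⟩).2) T.baseSet :=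
      (T.contMDiffOn_section_baseSet_iff).1 t.contMDiff.contMDiffOn
    have hc : ∀ i, ContMDiffOn 𝓘(ℝ, ℂ) 𝓘(ℝ, ℂ) ∞ (fun y => b.repr (T ⟨y, t y⟩).2 i) T.baseSet := by
      intro i
      let L : F →L[ℝ] ℂ := (LinearMap.toContinuousLinearMap (b.coord i)).restrictScalars ℝ
      have hL : ContDiff ℝ ∞ L := L.contDiff
      exact hL.contMDiff.comp_contMDiffOn ht
    choose a ha using fun i => exists_cfun_eventuallyEq T.open_baseSet hx (hc i)
    refine ⟨a, ?_⟩
    filter_upwards [he', T.open_baseSet.mem_nhds hx, eventually_all.2 ha] with y hy hyT hay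
    let β := b.map (T.continuousLinearEquivAt ℂ y hyT).symm.toLinearEquiv
    rw [← β.sum_repr (t y)]
    refine Finset.sum_congr rfl fun i _ => ?_
    rw [hay, hy, ← hb y hyT]
    simp [β]

variable {h : HermitianMetric F E}

/-- The value of a connection at a point depends only on the germ of the section. -/
lemma UnitaryConnection.congr_germ (A : UnitaryConnection h) {s t : Sec F E} {x : M}
    (hst : ∀ᶠ y in 𝓝 x, s y = t y) : A.toFun s x = A.toFun t x := by
  -- multiplying by a bump function equal to `1` near `x` changes neither side
  obtain ⟨U, hU, hUo, hxU⟩ := eventually_nhds_iff.1 hst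
  obtain ⟨χ, h1, h2⟩ := exists_bump hUo hxU
  let k : CFun M := ⟨fun y => ((χ y : ℝ) : ℂ),
    Complex.ofRealCLM.contDiff.comp_contMDiff χ.contMDiff⟩
  have hk : ∀ᶠ y in 𝓝 x, k y = 1 := by
    filter_upwards [h1] with y hy
    change ((χ y : ℝ) : ℂ) = 1
    rw [hy, Complex.ofReal_one]
  have hkx : k x = 1 := hk.self_of_nhds
  have key : ∀ s : Sec F E, A.toFun (fmul k s) x = A.toFun s x := by
    intro s
    ext v
    rw [A.leibniz, dfun_eq_zero_of_eventuallyEq_const hk, hkx, zero_smul, zero_add, one_smul]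
  rw [← key s, ← key t]
  congr 1
  ext y
  change k y • s y = k y • t y
  by_cases hy : y ∈ tsupport χ
  · rw [hU y (h2 hy)]
  · have : k y = 0 := by
      change ((χ y : ℝ) : ℂ) = 0
      rw [image_eq_zero_of_notMem_tsupport hy, Complex.ofReal_zero]
    rw [this, zero_smul, zero_smul]

lemma UnitaryConnection.toFun_zero (A : UnitaryConnection h) (x : M) : A.toFun 0 x = 0 := by
  simpa using A.add 0 0 x

lemma UnitaryConnection.toFun_neg (A : UnitaryConnection h) (s : Sec F E) (x : M) :
    A.toFun (-s) x = - A.toFun s x := by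
  have := A.add s (-s) x
  rw [add_neg_cancel, A.toFun_zero] at this
  exact (neg_eq_of_add_eq_zero_right this.symm).symm

lemma UnitaryConnection.toFun_sub (A : UnitaryConnection h) (s t : Sec F E) (x : M) :
    A.toFun (s - t) x = A.toFun s x - A.toFun t x := by
  rw [sub_eq_add_neg, A.add, A.toFun_neg, sub_eq_add_neg]

lemma UnitaryConnection.toFun_sum (A : UnitaryConnection h) {ι : Type*} (S : Finset ι)
    (s : ι → Sec F E) (x : M) : A.toFun (∑ i ∈ S, s i) x = ∑ i ∈ S, A.toFun (s i) x := by
  classical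
  induction S using Finset.induction_on with
  | empty => simpa using A.toFun_zero x
  | insert i S hi ih => rw [Finset.sum_insert hi, Finset.sum_insert hi, A.add, ih]

end Complex

/-! ### Linear algebra of Hermitian forms -/

section LinearAlgebra

variable {V : Type*} [AddCommGroup V] [Module ℂ V]

lemma trace_eq_sum_repr {ι : Type*} [Fintype ι] (b : Module.Basis ι ℂ V) (T : V →ₗ[ℂ] V) :
    LinearMap.trace ℂ V T = ∑ i, b.repr (T (b i)) i := by
  classical
  simp [LinearMap.trace_eq_matrix_trace ℂ b, Matrix.trace, LinearMap.toMatrix_apply]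

variable {H : V →ₗ⋆[ℂ] V →ₗ[ℂ] ℂ}

lemma eq_zero_of_hermitian_self (hp : ∀ e, e ≠ 0 → 0 < (H e e).re) {e : V} (he : H e e = 0) :
    e = 0 := by
  by_contra h
  have := hp e h
  rw [he] at this
  simp at this

/-- The inner product space structure given by a positive Hermitian form. -/
abbrev hermitianCore (hs : ∀ e e', starRingEnd ℂ (H e e') = H e' e)
    (hp : ∀ e, e ≠ 0 → 0 < (H e e).re) : InnerProductSpace.Core ℂ V where
  inner x y := H x y
  conj_inner_symm x y := hs y x
  re_inner_nonneg x := by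
    by_cases hx : x = 0
    · simp [hx]
    · exact (hp x hx).le
  add_left x y z := by simp
  smul_left x y r := by simp
  definite _ hx := eq_zero_of_hermitian_self hp hx

variable [FiniteDimensional ℂ V]

lemma exists_orthonormal_basis (hs : ∀ e e', starRingEnd ℂ (H e e') = H e' e)
    (hp : ∀ e, e ≠ 0 → 0 < (H e e).re) :
    ∃ b : Module.Basis (Fin (Module.finrank ℂ V)) ℂ V,
      ∀ i j, H (b i) (b j) = if i = j then 1 else 0 := by
  let core := hermitianCore hs hp
  let _ : NormedAddCommGroup V := core.toNormedAddCommGroup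
  let _ : InnerProductSpace ℂ V := InnerProductSpace.ofCore core.toCore
  let b := stdOrthonormalBasis ℂ V
  refine ⟨b.toBasis, fun i j => ?_⟩
  have := (orthonormal_iff_ite.1 b.orthonormal) i j
  rw [b.coe_toBasis]
  exact this

lemma trace_eq_sum_hermitian {ι : Type*} [Fintype ι] [DecidableEq ι] (b : Module.Basis ι ℂ V)
    (hb : ∀ i j, H (b i) (b j) = if i = j then 1 else 0) (T : V →ₗ[ℂ] V) :
    LinearMap.trace ℂ V T = ∑ i, H (b i) (T (b i)) := by
  rw [trace_eq_sum_repr b]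
  refine Finset.sum_congr rfl fun i _ => ?_
  have h1 := congrArg (H (b i)) (b.sum_repr (T (b i)))
  rw [map_sum] at h1
  rw [← h1]
  simp only [map_smul, hb, smul_eq_mul, mul_ite, mul_one, mul_zero, Finset.sum_ite_eq,
    Finset.mem_univ, if_true]

/-- An operator `T` with `H e' (T e) = H (B e') (B e)` has nonnegative trace, and the trace vanishes
only if `B` does. This is used both for the second fundamental form of a subbundle and for the
vanishing of parallel endomorphisms. -/
lemma trace_gram (hs : ∀ e e', starRingEnd ℂ (H e e') = H e' e)
    (hp : ∀ e, e ≠ 0 → 0 < (H e e).re) (B : V → V) (T : V →ₗ[ℂ] V)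
    (hT : ∀ e' e, H e' (T e) = H (B e') (B e)) :
    ∃ r : ℝ, 0 ≤ r ∧ LinearMap.trace ℂ V T = r ∧ (r = 0 → ∀ e, B e = 0) := by
  obtain ⟨b, hb⟩ := exists_orthonormal_basis hs hp
  have hre : ∀ e, H e e = ((H e e).re : ℂ) := fun e => (Complex.conj_eq_iff_re.1 (hs e e)).symm
  have hnn : ∀ e, 0 ≤ (H e e).re := fun e => by
    by_cases h : e = 0
    · simp [h]
    · exact (hp e h).le
  refine ⟨∑ i, (H (B (b i)) (B (b i))).re, Finset.sum_nonneg fun i _ => hnn _, ?_, fun h0 e => ?_⟩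
  · rw [trace_eq_sum_hermitian b hb, Complex.ofReal_sum]
    exact Finset.sum_congr rfl fun i _ => (hT _ _).trans (hre _)
  · have h1 := (Finset.sum_eq_zero_iff_of_nonneg fun i _ => hnn _).1 h0
    have h2 : ∀ i, B (b i) = 0 := fun i =>
      eq_zero_of_hermitian_self hp ((hre _).trans (by rw [h1 i (Finset.mem_univ i)]; simp))
    have h3 : T = 0 := b.ext fun i => eq_zero_of_hermitian_self hp (by
      rw [hT, h2 i]; simp)
    exact eq_zero_of_hermitian_self hp (by rw [← hT, h3]; simp)

end LinearAlgebra

/-! ### Traces of endomorphism fields -/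

section Trace

variable {M : Type*} [TopologicalSpace M] [T2Space M] [CompactSpace M] [ChartedSpace ℂ M]
  [IsManifold 𝓘(ℂ) ω M]

lemma eventually_eq_of_dfun_eq_zero {f : M → ℂ} (hf : ContMDiff 𝓘(ℝ, ℂ) 𝓘(ℝ, ℂ) ∞ f)
    (h0 : ∀ x v, dfun f x v = 0) (x : M) : ∀ᶠ y in 𝓝 x, f y = f x := by
  set φ := chartAt ℂ x
  have hx : φ x ∈ φ.target := mem_chart_target ℂ x
  obtain ⟨r, hr, hball⟩ := Metric.isOpen_iff.1 φ.open_target _ hx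
  have hm : ∀ z ∈ φ.target, MDifferentiableAt 𝓘(ℝ, ℂ) 𝓘(ℝ, ℂ) φ.symm z := fun z hz =>
    ((contMDiffOn_chart_symm (I := 𝓘(ℝ, ℂ)) (n := ∞) (x := x)).contMDiffAt
      (φ.open_target.mem_nhds hz)).mdifferentiableAt (by simp)
  have hfm : ∀ y, MDifferentiableAt 𝓘(ℝ, ℂ) 𝓘(ℝ, ℂ) f y := fun y =>
    (hf y).mdifferentiableAt (by simp)
  have hd : ∀ z ∈ φ.target, MDifferentiableAt 𝓘(ℝ, ℂ) 𝓘(ℝ, ℂ) (f ∘ φ.symm) z := fun z hz =>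
    (hfm _).comp z (hm z hz)
  have hz : ∀ z ∈ φ.target, fderiv ℝ (f ∘ φ.symm) z = 0 := by
    intro z hz
    rw [← mfderiv_eq_fderiv, mfderiv_comp z (hfm _) (hm z hz)]
    exact ContinuousLinearMap.ext fun v => h0 (φ.symm z) (mfderiv 𝓘(ℝ, ℂ) 𝓘(ℝ, ℂ) φ.symm z v)
  have hconst : ∀ z ∈ Metric.ball (φ x) r, (f ∘ φ.symm) z = (f ∘ φ.symm) (φ x) := fun z hz' =>
    Metric.isOpen_ball.is_const_of_fderiv_eq_zero (convex_ball _ _).isPreconnected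
      (fun w hw => (mdifferentiableAt_iff_differentiableAt.1
        (hd w (hball hw))).differentiableWithinAt)
      (fun w hw => hz w (hball hw)) hz' (Metric.mem_ball_self hr)
  filter_upwards [φ.open_source.mem_nhds (mem_chart_source ℂ x),
    (φ.continuousAt (mem_chart_source ℂ x)).preimage_mem_nhds (Metric.ball_mem_nhds _ hr)]
    with y hy hy'
  simpa [φ.left_inv hy, φ.left_inv (mem_chart_source ℂ x)] using hconst _ hy'

lemma eq_of_dfun_eq_zero [ConnectedSpace M] {f : M → ℂ} (hf : ContMDiff 𝓘(ℝ, ℂ) 𝓘(ℝ, ℂ) ∞ f)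
    (h0 : ∀ x v, dfun f x v = 0) (x y : M) : f x = f y :=
  ((IsLocallyConstant.iff_eventually_eq f).2
    (eventually_eq_of_dfun_eq_zero hf h0)).apply_eq_of_preconnectedSpace x y

variable {F : Type*} [NormedAddCommGroup F] [NormedSpace ℂ F] [FiniteDimensional ℂ F]
  {E : M → Type*} [TopologicalSpace (TotalSpace F E)] [∀ x, TopologicalSpace (E x)]
  [FiberBundle F E] [∀ x, AddCommGroup (E x)] [∀ x, Module ℂ (E x)]
  [VectorBundle ℂ F E] [ContMDiffVectorBundle ∞ F E 𝓘(ℝ, ℂ)]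

/-- The matrix of a smooth endomorphism field in a smooth local frame, whose diagonal sums to the
trace. -/
lemma exists_local_matrix {ψ : ∀ x, E x →ₗ[ℂ] E x}
    (hψ : ∀ s : Sec F E, SmoothSec F (fun x => ψ x (s x))) (x₀ : M) :
    ∃ (e : Fin (Module.finrank ℂ F) → Sec F E)
      (a : Fin (Module.finrank ℂ F) → Fin (Module.finrank ℂ F) → CFun M),
      ∀ᶠ y in 𝓝 x₀, LinearMap.trace ℂ (E y) (ψ y) = ∑ i, a i i y ∧
        (∃ β : Module.Basis (Fin (Module.finrank ℂ F)) ℂ (E y), ∀ i, β i = e i y) ∧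
        ∀ j, ψ y (e j y) = ∑ i, a j i y • e i y := by
  obtain ⟨e, he, hcoef⟩ := exists_local_frame (F := F) (E := E) x₀
  choose a ha using fun j => hcoef ⟨_, hψ (e j)⟩
  refine ⟨e, a, ?_⟩
  filter_upwards [he, eventually_all.2 ha] with y ⟨β, hβ⟩ hay
  have := finiteDimensional_fiber (F := F) (E := E) y
  have h1 : ∀ j, ψ y (e j y) = ∑ i, a j i y • e i y := hay
  refine ⟨?_, ⟨β, hβ⟩, h1⟩
  rw [trace_eq_sum_repr β]
  refine Finset.sum_congr rfl fun j _ => ?_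
  rw [hβ, h1]
  simp [← hβ, Finsupp.single_apply]

lemma contMDiff_trace {ψ : ∀ x, E x →ₗ[ℂ] E x}
    (hψ : ∀ s : Sec F E, SmoothSec F (fun x => ψ x (s x))) :
    ContMDiff 𝓘(ℝ, ℂ) 𝓘(ℝ, ℂ) ∞ (fun x => LinearMap.trace ℂ (E x) (ψ x)) := by
  intro x₀
  obtain ⟨e, a, ha⟩ := exists_local_matrix hψ x₀
  have : ContMDiffAt 𝓘(ℝ, ℂ) 𝓘(ℝ, ℂ) ∞ (fun x => ∑ i, a i i x) x₀ :=
    contMDiffAt_finsetSum fun i _ => (a i i).contMDiff x₀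
  exact this.congr_of_eventuallyEq (ha.mono fun y hy => hy.1)

lemma dfun_sum {ι : Type} (S : Finset ι) (f : ι → CFun M) (x : M) (v : Tan x) :
    dfun (fun y => ∑ i ∈ S, f i y) x v = ∑ i ∈ S, dfun (f i) x v := by
  have h := HasMFDerivAt.sum (I := 𝓘(ℝ, ℂ)) (E' := ℂ) (t := S) (f := fun i => (f i : M → ℂ))
    (z := x) (f' := fun i => (mfderiv 𝓘(ℝ, ℂ) 𝓘(ℝ, ℂ) (f i) x : TangentSpace 𝓘(ℝ, ℂ) x →L[ℝ] ℂ))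
    (fun i _ => (((f i).contMDiff x).mdifferentiableAt (by simp)).hasMFDerivAt)
  have h1 : (fun y => ∑ i ∈ S, f i y) = ∑ i ∈ S, (f i : M → ℂ) := by
    ext y
    rw [Finset.sum_apply]
  rw [h1, dfun, h.mfderiv]
  exact sum_apply (F := ℂ →L[ℝ] ℂ) S
    (fun i => (mfderiv 𝓘(ℝ, ℂ) 𝓘(ℝ, ℂ) (f i) x : TangentSpace 𝓘(ℝ, ℂ) x →L[ℝ] ℂ)) v

variable {h : HermitianMetric F E}

/-- A smooth endomorphism field of `E` commuting with a connection, i.e. a parallel section of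
`End E`. -/
structure UnitaryConnection.IsParallel (A : UnitaryConnection h) (ψ : ∀ x, E x →ₗ[ℂ] E x) :
    Prop where
  smooth : ∀ s : Sec F E, SmoothSec F (fun x => ψ x (s x))
  comm : ∀ (s : Sec F E) (x : M) (v : Tan x),
    A.toFun ⟨_, smooth s⟩ x v = ψ x (A.toFun s x v)

/-- In a local frame the matrix `a` of a parallel endomorphism satisfies `da = [a, ω]`, where `ω` is
the connection matrix; hence its trace has vanishing differential. -/
lemma UnitaryConnection.IsParallel.dfun_trace {A : UnitaryConnection h}
    {ψ : ∀ x, E x →ₗ[ℂ] E x} (hψ : A.IsParallel ψ) (x : M) (v : Tan x) :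
    dfun (fun y => LinearMap.trace ℂ (E y) (ψ y)) x v = 0 := by
  obtain ⟨e, a, ha⟩ := exists_local_matrix hψ.smooth x
  have := finiteDimensional_fiber (F := F) (E := E) x
  rw [dfun_congr (ha.mono fun y hy => hy.1) v, dfun_sum]
  obtain ⟨-, ⟨β, hβ⟩, hψe⟩ := ha.self_of_nhds
  -- `W` is the connection matrix and `S` the differential of `a`, read as operators on `E x`
  let W : E x →ₗ[ℂ] E x := β.constr ℂ fun j => A.toFun (e j) x v
  let S : E x →ₗ[ℂ] E x := β.constr ℂ fun j => ∑ i, dfun (a j i) x v • e i x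
  have hWe : ∀ j, W (e j x) = A.toFun (e j) x v := fun j => by rw [← hβ, Module.Basis.constr_basis]
  have hSe : ∀ j, S (e j x) = ∑ i, dfun (a j i) x v • e i x := fun j => by
    rw [← hβ, Module.Basis.constr_basis]
  have hS : S = ψ x ∘ₗ W - W ∘ₗ ψ x := by
    refine β.ext fun j => ?_
    have h1 : A.toFun ⟨_, hψ.smooth (e j)⟩ x = A.toFun (∑ i, fmul (a j i) (e i)) x := by
      refine A.congr_germ (ha.mono fun y hy => ?_)
      refine (hy.2.2 j).trans ?_
      exact (congrArg (fun k => k y) (map_sum (ContMDiffSection.coeAddHom 𝓘(ℝ, ℂ) F ∞ E)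
        (fun i => fmul (a j i) (e i)) Finset.univ)).trans (Finset.sum_apply _ _ _) |>.symm
    have h2 := congrArg (fun L => L v) h1
    simp only [hψ.comm, A.toFun_sum, LinearMap.sum_apply, A.leibniz, Finset.sum_add_distrib] at h2
    rw [LinearMap.sub_apply, LinearMap.comp_apply, LinearMap.comp_apply, hβ, hSe, hWe, hψe, h2,
      map_sum]
    simp [hWe]
  have h3 : LinearMap.trace ℂ (E x) S = 0 := by
    rw [hS, map_sub, sub_eq_zero]
    exact LinearMap.trace_mul_comm ℂ (ψ x) W
  rw [← h3, trace_eq_sum_repr β]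
  refine Finset.sum_congr rfl fun j _ => ?_
  rw [hβ, hSe]
  simp [← hβ, Finsupp.single_apply]

/-- A parallel endomorphism with a parallel adjoint vanishes if it vanishes at one point. -/
lemma UnitaryConnection.IsParallel.eq_zero [ConnectedSpace M] {A : UnitaryConnection h}
    {ψ ψ' : ∀ x, E x →ₗ[ℂ] E x} (hψ : A.IsParallel ψ) (hψ' : A.IsParallel ψ')
    (hadj : ∀ x e e', h.toFun x (ψ x e) e' = h.toFun x e (ψ' x e')) {x₀ : M} (h0 : ψ x₀ = 0)
    (x : M) : ψ x = 0 := by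
  have hp : A.IsParallel fun x => ψ' x ∘ₗ ψ x :=
    ⟨fun s => hψ'.smooth ⟨_, hψ.smooth s⟩, fun s x v => by
      rw [LinearMap.comp_apply, ← hψ.comm, ← hψ'.comm]; rfl⟩
  have htr := eq_of_dfun_eq_zero (contMDiff_trace hp.smooth) hp.dfun_trace x x₀
  have := finiteDimensional_fiber (F := F) (E := E) x
  obtain ⟨r, -, hr, hr0⟩ := trace_gram (h.conj_symm x) (h.pos x) (ψ x) (ψ' x ∘ₗ ψ x)
    (fun e' e => (hadj x e' (ψ x e)).symm)
  refine LinearMap.ext fun e => hr0 ?_ e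
  rw [hr, h0, LinearMap.comp_zero, map_zero] at htr
  exact_mod_cast htr

end Trace

/-! ### Coordinate frames of holomorphic charts -/

section Chart

variable {M : Type*} [TopologicalSpace M] [ChartedSpace ℂ M] [IsManifold 𝓘(ℂ) ω M]

/-- The coordinate vector field `∂/∂x` of the chart centred at `c`, at the point with
coordinate `z`. -/
def coordVec (c : M) (z : ℂ) : Tan ((chartAt ℂ c).symm z) :=
  mfderiv 𝓘(ℝ, ℂ) 𝓘(ℝ, ℂ) (chartAt ℂ c).symm z (1 : ℂ)

/-- Since charts are holomorphic, `∂/∂y = J ∂/∂x`. -/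
lemma mfderiv_chart_symm_I {c : M} {z : ℂ} (hz : z ∈ (chartAt ℂ c).target) :
    (mfderiv 𝓘(ℝ, ℂ) 𝓘(ℝ, ℂ) (chartAt ℂ c).symm z Complex.I : Tan ((chartAt ℂ c).symm z)) =
      J _ (coordVec c z) := by
  have h1 : MDifferentiableAt 𝓘(ℂ) 𝓘(ℂ) (chartAt ℂ c).symm z :=
    ((contMDiffOn_chart_symm (I := 𝓘(ℂ)) (n := ω) (x := c)).contMDiffAt
      ((chartAt ℂ c).open_target.mem_nhds hz)).mdifferentiableAt (by simp)
  have h2 : MDifferentiableAt 𝓘(ℝ, ℂ) 𝓘(ℝ, ℂ) (chartAt ℂ c).symm z :=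
    ((contMDiffOn_chart_symm (I := 𝓘(ℝ, ℂ)) (n := ∞) (x := c)).contMDiffAt
      ((chartAt ℂ c).open_target.mem_nhds hz)).mdifferentiableAt (by simp)
  set k : ℂ → ℂ := writtenInExtChartAt 𝓘(ℂ) 𝓘(ℂ) z (chartAt ℂ c).symm with hk
  have hd : DifferentiableAt ℂ k z := by
    exact h1.differentiableWithinAt_writtenInExtChartAt.differentiableAt (by simp)
  have e1 : ∀ v : ℂ, (mfderiv 𝓘(ℝ, ℂ) 𝓘(ℝ, ℂ) (chartAt ℂ c).symm z v : ℂ) = fderiv ℂ k z v := by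
    intro v
    have h3 : fderiv ℝ k z = (fderiv ℂ k z).restrictScalars ℝ := hd.fderiv_restrictScalars ℝ
    have h4 : (mfderiv 𝓘(ℝ, ℂ) 𝓘(ℝ, ℂ) (chartAt ℂ c).symm z : ℂ →L[ℝ] ℂ) = fderiv ℝ k z := by
      rw [h2.mfderiv, ← fderivWithin_univ, show range 𝓘(ℝ, ℂ) = univ by simp]
      rfl
    exact (congrArg (fun L : ℂ →L[ℝ] ℂ => L v) (h4.trans h3))
  refine (e1 Complex.I).trans (Eq.trans ?_ (congrArg (Complex.I * ·) (e1 1)).symm)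
  have h5 := (fderiv ℂ k z).map_smul Complex.I 1
  rwa [smul_eq_mul, mul_one] at h5

lemma coordVec_eq_symm {c : M} {y : M} (hy : y ∈ (chartAt ℂ c).source) :
    (mfderiv 𝓘(ℝ, ℂ) 𝓘(ℝ, ℂ) (chartAt ℂ c).symm (chartAt ℂ c y) (1 : ℂ) : ℂ) =
      (trivializationAt ℂ (fun x : M => TangentSpace 𝓘(ℝ, ℂ) x) c).symm y (1 : ℂ) := by
  have h := TangentBundle.symmL_trivializationAt (I := 𝓘(ℝ, ℂ)) (x₀ := c) hy
  have h2 := congrArg (fun L : ℂ →L[ℝ] ℂ => L 1) h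
  refine Eq.trans ?_ (h2.symm.trans (Trivialization.symmL_apply (R := ℝ)
    (trivializationAt ℂ (fun x : M => TangentSpace 𝓘(ℝ, ℂ) x) c)
    (by simpa using hy) (1 : ℂ)))
  have h3 : mfderivWithin 𝓘(ℝ, ℂ) 𝓘(ℝ, ℂ) (extChartAt 𝓘(ℝ, ℂ) c).symm (range 𝓘(ℝ, ℂ))
      (extChartAt 𝓘(ℝ, ℂ) c y) =
      mfderiv 𝓘(ℝ, ℂ) 𝓘(ℝ, ℂ) (extChartAt 𝓘(ℝ, ℂ) c).symm (extChartAt 𝓘(ℝ, ℂ) c y) := by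
    rw [show range 𝓘(ℝ, ℂ) = univ by simp, mfderivWithin_univ]
  exact (congrArg (fun L : ℂ →L[ℝ] ℂ => L 1) h3).symm

lemma coordVec_ne_zero {c : M} {z : ℂ} (hz : z ∈ (chartAt ℂ c).target) : coordVec c z ≠ 0 := by
  intro h0
  have h2 : MDifferentiableAt 𝓘(ℝ, ℂ) 𝓘(ℝ, ℂ) (chartAt ℂ c).symm z :=
    ((contMDiffOn_chart_symm (I := 𝓘(ℝ, ℂ)) (n := ∞) (x := c)).contMDiffAt
      ((chartAt ℂ c).open_target.mem_nhds hz)).mdifferentiableAt (by simp)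
  have h3 : MDifferentiableAt 𝓘(ℝ, ℂ) 𝓘(ℝ, ℂ) (chartAt ℂ c) ((chartAt ℂ c).symm z) :=
    ((contMDiffOn_chart (I := 𝓘(ℝ, ℂ)) (n := ∞) (x := c)).contMDiffAt
      ((chartAt ℂ c).open_source.mem_nhds ((chartAt ℂ c).map_target hz))).mdifferentiableAt
        (by simp)
  have h4 := mfderiv_comp z h3 h2
  have h5 : mfderiv 𝓘(ℝ, ℂ) 𝓘(ℝ, ℂ) (chartAt ℂ c ∘ (chartAt ℂ c).symm) z =
      ContinuousLinearMap.id ℝ ℂ := by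
    have : chartAt ℂ c ∘ (chartAt ℂ c).symm =ᶠ[𝓝 z] id := by
      filter_upwards [(chartAt ℂ c).open_target.mem_nhds hz] with w hw
      exact (chartAt ℂ c).right_inv hw
    rw [mfderiv_eq_fderiv, this.fderiv_eq, fderiv_id]
  have h6 := congrArg (fun L : ℂ →L[ℝ] ℂ => L 1) (h5.symm.trans h4)
  have h7 : (1 : ℂ) = mfderiv 𝓘(ℝ, ℂ) 𝓘(ℝ, ℂ) (chartAt ℂ c) ((chartAt ℂ c).symm z)
    (coordVec c z) := h6
  rw [h0] at h7
  exact one_ne_zero (h7.trans (_root_.map_zero _))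

lemma formCoeff_eq (η : ∀ x : M, Tan x → Tan x → ℂ) {c : M} {z : ℂ}
    (hz : z ∈ (chartAt ℂ c).target) :
    formCoeff η c z = η _ (coordVec c z) (J _ (coordVec c z)) :=
  congrArg (η _ (coordVec c z)) (mfderiv_chart_symm_I hz)

variable [T2Space M] [CompactSpace M]

/-- The coordinate vector field `∂/∂x` extends from a neighbourhood of any point of the chart to a
smooth vector field on the surface. -/
lemma exists_vfield_eq_coordVec {c : M} {z : ℂ} (hz : z ∈ (chartAt ℂ c).target) :
    ∃ X : VField M, ∀ᶠ w in 𝓝 z, X ((chartAt ℂ c).symm w) = coordVec c w := by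
  have hx := (chartAt ℂ c).map_target hz
  obtain ⟨X, hX⟩ := exists_section_eventuallyEq_symm
    (V := fun x : M => TangentSpace 𝓘(ℝ, ℂ) x) c (x := (chartAt ℂ c).symm z)
    (by simpa using hx) (1 : ℂ)
  refine ⟨X, ?_⟩
  filter_upwards [((chartAt ℂ c).continuousAt_symm hz).eventually hX,
    (chartAt ℂ c).open_target.mem_nhds hz] with w hw hwt
  rw [hw]
  have := coordVec_eq_symm ((chartAt ℂ c).map_target hwt)
  rw [(chartAt ℂ c).right_inv hwt] at this
  exact this.symm

/-! ### Integration of continuous 2-forms -/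

/-- A 2-form whose coefficients in the holomorphic charts are continuous. -/
def ContinuousForm (η : ∀ x : M, Tan x → Tan x → ℂ) : Prop :=
  ∀ c : M, ContinuousOn (formCoeff η c) (chartAt ℂ c).target

lemma continuousForm_of_vfield {η : ∀ x : M, Tan x → Tan x → ℂ}
    (hη : ∀ X Y : VField M, Continuous fun x => η x (X x) (Y x)) : ContinuousForm η := by
  intro c z hz
  obtain ⟨X, hX⟩ := exists_vfield_eq_coordVec hz
  refine ContinuousAt.continuousWithinAt ?_
  have h1 : ContinuousAt (fun w => η ((chartAt ℂ c).symm w) (X ((chartAt ℂ c).symm w))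
      (X.rotate ((chartAt ℂ c).symm w))) z :=
    ContinuousAt.comp (g := fun x => η x (X x) (X.rotate x)) (hη X X.rotate).continuousAt
      ((chartAt ℂ c).continuousAt_symm hz)
  refine h1.congr ?_
  filter_upwards [hX, (chartAt ℂ c).open_target.mem_nhds hz] with w hw hwt
  rw [formCoeff_eq η hwt, ← hw]
  rfl

/-- The contribution of the chart centred at `c` to the integral of a 2-form. -/
def chartIntegral (η : ∀ x : M, Tan x → Tan x → ℂ) (c : M) : ℂ :=
  ∫ z in (chartAt ℂ c).target,
    (chartPartition M c ((chartAt ℂ c).symm z) : ℂ) * formCoeff η c z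

lemma tsupport_chartPartition_subset (c : M) :
    tsupport (chartPartition M c) ⊆ (chartAt ℂ c).source :=
  Classical.choose_spec (SmoothPartitionOfUnity.exists_isSubordinate_chartAt_source 𝓘(ℝ, ℂ) M) c

lemma continuousOn_chartPartition_symm (c : M) :
    ContinuousOn (fun z => (chartPartition M c ((chartAt ℂ c).symm z) : ℂ))
      (chartAt ℂ c).target :=
  Complex.continuous_ofReal.comp_continuousOn
    ((chartPartition M c).contMDiff.continuous.comp_continuousOn (chartAt ℂ c).continuousOn_symm)

lemma finite_support_chartIntegral (η : ∀ x : M, Tan x → Tan x → ℂ) :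
    (Function.support (chartIntegral η)).Finite := by
  refine ((chartPartition M).locallyFinite.finite_nonempty_of_compact).subset fun c hc => ?_
  by_contra hne
  refine hc ?_
  have h0 : ∀ x, chartPartition M c x = 0 := fun x => by
    by_contra h
    exact hne ⟨x, h⟩
  simp [chartIntegral, h0]

lemma integrableOn_chart {η : ∀ x : M, Tan x → Tan x → ℂ} (hη : ContinuousForm η) (c : M) :
    MeasureTheory.IntegrableOn (fun z => (chartPartition M c ((chartAt ℂ c).symm z) : ℂ) *
      formCoeff η c z) (chartAt ℂ c).target := by
  set φ := chartAt ℂ c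
  have hK : IsCompact (φ '' tsupport (chartPartition M c)) :=
    (isClosed_tsupport _).isCompact.image_of_continuousOn
      (φ.continuousOn.mono (tsupport_chartPartition_subset c))
  have hKt : φ '' tsupport (chartPartition M c) ⊆ φ.target := by
    rintro _ ⟨x, hx, rfl⟩
    exact φ.map_source (tsupport_chartPartition_subset c hx)
  have hcont := (continuousOn_chartPartition_symm c).mul (hη c)
  refine ((hcont.mono hKt).integrableOn_compact hK).of_forall_sdiff_eq_zero
    φ.open_target.measurableSet fun z hz => ?_
  have : chartPartition M c (φ.symm z) = 0 := by
    refine image_eq_zero_of_notMem_tsupport fun h => hz.2 ⟨_, h, φ.right_inv hz.1⟩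
  change (chartPartition M c (φ.symm z) : ℂ) * formCoeff η c z = 0
  rw [this, Complex.ofReal_zero, zero_mul]

lemma integralForm_linear {η θ : ∀ x : M, Tan x → Tan x → ℂ} (hη : ContinuousForm η)
    (hθ : ContinuousForm θ) (a b : ℂ) :
    integralForm (fun x v w => a * η x v w + b * θ x v w) =
      a * integralForm η + b * integralForm θ := by
  have h1 : ∀ c, chartIntegral (fun x v w => a * η x v w + b * θ x v w) c =
      a * chartIntegral η c + b * chartIntegral θ c := by
    intro c
    unfold chartIntegral
    rw [← MeasureTheory.integral_const_mul, ← MeasureTheory.integral_const_mul,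
      ← MeasureTheory.integral_add ((integrableOn_chart hη c).const_mul a)
        ((integrableOn_chart hθ c).const_mul b)]
    refine MeasureTheory.integral_congr_ae (Eventually.of_forall fun z => ?_)
    simp only [formCoeff]
    ring
  have h2 : ∀ η : ∀ x : M, Tan x → Tan x → ℂ, integralForm η = ∑ᶠ c, chartIntegral η c :=
    fun η => rfl
  rw [h2, h2, h2, finsum_congr h1, finsum_add_distrib]
  · rw [mul_finsum, mul_finsum]
  · exact (finite_support_chartIntegral η).subset fun c hc => right_ne_zero_of_mul hc
  · exact (finite_support_chartIntegral θ).subset fun c hc => right_ne_zero_of_mul hc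

lemma integralForm_eq_zero {θ : ∀ x : M, Tan x → Tan x → ℂ} (hθ : ∀ x v, θ x v (J x v) = 0) :
    integralForm θ = 0 := by
  refine (finsum_congr fun c => ?_).trans finsum_zero
  rw [MeasureTheory.setIntegral_congr_fun (g := fun _ => 0)
    (chartAt ℂ c).open_target.measurableSet fun z hz => ?_]
  · simp
  · simp only [formCoeff_eq θ hz, hθ, mul_zero]

/-- A continuous 2-form which is nonnegative with respect to the complex orientation has nonnegative
integral, and the form vanishes if its integral does. -/
lemma integralForm_nonneg {θ : ∀ x : M, Tan x → Tan x → ℂ} (hθ : ContinuousForm θ)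
    (hpos : ∀ x v, ∃ r : ℝ, 0 ≤ r ∧ θ x v (J x v) = r) :
    ∃ I : ℝ, 0 ≤ I ∧ integralForm θ = I ∧
      (I = 0 → ∀ x, ∃ v, v ≠ 0 ∧ θ x v (J x v) = 0) := by
  let f : M → ℂ → ℝ := fun c z => chartPartition M c ((chartAt ℂ c).symm z) * (formCoeff θ c z).re
  have hre : ∀ c, ∀ z ∈ (chartAt ℂ c).target, 0 ≤ (formCoeff θ c z).re ∧
      formCoeff θ c z = ((formCoeff θ c z).re : ℂ) := by
    intro c z hz
    obtain ⟨r, hr, h⟩ := hpos _ (coordVec c z)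
    rw [formCoeff_eq θ hz, h]
    simpa using hr
  have hf0 : ∀ c, ∀ z ∈ (chartAt ℂ c).target, 0 ≤ f c z := fun c z hz =>
    mul_nonneg ((chartPartition M).nonneg c _) (hre c z hz).1
  have hfc : ∀ c, ContinuousOn (f c) (chartAt ℂ c).target := fun c =>
    ((chartPartition M c).contMDiff.continuous.comp_continuousOn
      (chartAt ℂ c).continuousOn_symm).mul (Complex.continuous_re.comp_continuousOn (hθ c))
  have hfeq : ∀ c, ∀ z ∈ (chartAt ℂ c).target,
      (chartPartition M c ((chartAt ℂ c).symm z) : ℂ) * formCoeff θ c z = (f c z : ℂ) := by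
    intro c z hz
    rw [(hre c z hz).2]
    simp [f]
  have hfi : ∀ c, MeasureTheory.IntegrableOn (f c) (chartAt ℂ c).target := by
    intro c
    have h1 := (integrableOn_chart hθ c).congr_fun (hfeq c) (chartAt ℂ c).open_target.measurableSet
    exact MeasureTheory.Integrable.re h1
  let Ic : M → ℝ := fun c => ∫ z in (chartAt ℂ c).target, f c z
  have hIc : ∀ c, chartIntegral θ c = (Ic c : ℂ) := by
    intro c
    rw [chartIntegral, MeasureTheory.setIntegral_congr_fun
      (chartAt ℂ c).open_target.measurableSet (hfeq c)]
    exact integral_ofReal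
  have hIc0 : ∀ c, 0 ≤ Ic c := fun c =>
    MeasureTheory.setIntegral_nonneg (chartAt ℂ c).open_target.measurableSet (hf0 c)
  have hfin : (Function.support Ic).Finite := by
    refine (finite_support_chartIntegral θ).subset fun c hc => ?_
    rw [Function.mem_support, hIc]
    exact_mod_cast hc
  refine ⟨∑ᶠ c, Ic c, finsum_nonneg hIc0, ?_, fun h0 x => ?_⟩
  · change ∑ᶠ c, chartIntegral θ c = _
    rw [finsum_congr hIc]
    exact (Complex.ofRealHom.toAddMonoidHom.map_finsum hfin).symm
  · rw [finsum_eq_sum _ hfin] at h0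
    have hz : ∀ c, Ic c = 0 := by
      intro c
      by_contra hc
      exact hc ((Finset.sum_eq_zero_iff_of_nonneg fun c _ => hIc0 c).1 h0 c (by simpa using hc))
    obtain ⟨c, hc⟩ := (chartPartition M).exists_pos_of_mem (mem_univ x)
    have hxs : x ∈ (chartAt ℂ c).source :=
      tsupport_chartPartition_subset c (subset_tsupport _ hc.ne')
    have hxt := (chartAt ℂ c).map_source hxs
    have h1 := (MeasureTheory.setIntegral_eq_zero_iff_of_nonneg_ae
      ((MeasureTheory.ae_restrict_iff' (chartAt ℂ c).open_target.measurableSet).2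
        (Eventually.of_forall (hf0 c))) (hfi c)).1 (hz c)
    have h2 : EqOn (f c) 0 (chartAt ℂ c).target :=
      MeasureTheory.Measure.eqOn_open_of_ae_eq h1 (chartAt ℂ c).open_target (hfc c)
        continuousOn_const
    have h3 := h2 hxt
    simp only [f, (chartAt ℂ c).left_inv hxs, Pi.zero_apply, mul_eq_zero, hc.ne', false_or] at h3
    have h4 : formCoeff θ c (chartAt ℂ c x) = 0 := by
      rw [(hre c _ hxt).2, h3, Complex.ofReal_zero]
    rw [formCoeff_eq θ hxt] at h4
    have h5 := coordVec_ne_zero hxt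
    revert h4 h5
    generalize coordVec c (chartAt ℂ c x) = v
    revert v
    rw [(chartAt ℂ c).left_inv hxs]
    exact fun v h4 h5 => ⟨v, h5, h4⟩

end Chart

section Curvature

variable {M : Type*} [TopologicalSpace M] [T2Space M] [CompactSpace M] [ChartedSpace ℂ M]
  [IsManifold 𝓘(ℂ) ω M]
  {F : Type*} [NormedAddCommGroup F] [NormedSpace ℂ F] [FiniteDimensional ℂ F]
  {E : M → Type*} [TopologicalSpace (TotalSpace F E)] [∀ x, TopologicalSpace (E x)]
  [FiberBundle F E] [∀ x, AddCommGroup (E x)] [∀ x, Module ℂ (E x)]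
  [VectorBundle ℂ F E] [ContMDiffVectorBundle ∞ F E 𝓘(ℝ, ℂ)]
  {h : HermitianMetric F E}

/-! ### Uniqueness of the Chern connection -/

lemma HermitianMetric.eq_zero {x : M} {e : E x} (he : ∀ e', h.toFun x e e' = 0) : e = 0 :=
  eq_zero_of_hermitian_self (h.pos x) (he e)

lemma UnitaryConnection.dolbeault_apply (A : UnitaryConnection h) (s : Sec F E) (x : M)
    (v : Tan x) : A.dolbeault.toFun s x v =
      (1 / 2 : ℂ) • (A.toFun s x v + Complex.I • A.toFun s x (J x v)) := rfl

/-- The difference `a` of two unitary connections with the same Dolbeault operator is skew-Hermitian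
and satisfies `a (J v) = i a (v)`, which forces `a = 0`. -/
lemma UnitaryConnection.dolbeault_injective :
    Function.Injective (UnitaryConnection.dolbeault : UnitaryConnection h → _) := by
  intro A B hAB
  let a : Sec F E → ∀ x : M, Tan x → E x := fun s x v => A.toFun s x v - B.toFun s x v
  have hJ : ∀ s x v, a s x (J x v) = Complex.I • a s x v := by
    intro s x v
    have h1 : A.dolbeault.toFun s x v = B.dolbeault.toFun s x v := by rw [hAB]
    rw [dolbeault_apply, dolbeault_apply] at h1
    have h2 := smul_right_injective (E x) (by norm_num : (1 / 2 : ℂ) ≠ 0) h1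
    have h3 : a s x v + Complex.I • a s x (J x v) = 0 := by
      simp only [a, smul_sub]
      rw [← sub_eq_zero] at h2
      rw [← h2]
      abel
    have h4 := congrArg (fun e => Complex.I • e) h3
    simp only [smul_add, smul_smul, Complex.I_mul_I, neg_smul, one_smul, smul_zero] at h4
    rw [← sub_eq_add_neg, sub_eq_zero] at h4
    exact h4.symm
  have hskew : ∀ s t x v, h.toFun x (a s x v) (t x) + h.toFun x (s x) (a t x v) = 0 := by
    intro s t x v
    have h1 := (A.unitary s t x v).symm.trans (B.unitary s t x v)
    simp only [a, _root_.map_sub, LinearMap.sub_apply]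
    linear_combination h1
  ext s x v
  rw [← sub_eq_zero]
  refine HermitianMetric.eq_zero (h := h) fun e' => ?_
  obtain ⟨t, rfl⟩ := exists_sec_apply_eq (F := F) x e'
  have h1 := hskew s t x v
  have h2 := hskew s t x (J x v)
  rw [hJ, hJ, LinearMap.map_smulₛₗ, LinearMap.smul_apply, LinearMap.map_smul] at h2
  simp only [Complex.conj_I, smul_eq_mul] at h2
  have h3 : Complex.I * (h.toFun x (a s x v) (t x) - h.toFun x (s x) (a t x v)) = 0 := by
    linear_combination -h2
  have h4 := (mul_eq_zero.1 h3).resolve_left Complex.I_ne_zero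
  change h.toFun x (a s x v) (t x) = 0
  linear_combination (1 / 2 : ℂ) * h1 + (1 / 2 : ℂ) * h4

/-! ### Second fundamental forms of subbundles -/

/-- The covariant derivative of a section along a vector field. -/
def UnitaryConnection.nabla (A : UnitaryConnection h) (X : VField M) (s : Sec F E) : Sec F E :=
  ⟨fun x => A.toFun s x (X x), A.smooth s X⟩

/-- The second fundamental form of the subbundle `P`, precomposed with the projection to `P`:
`s ↦ (1 - P) (d_A (P s) (v))`. -/
def UnitaryConnection.secondForm (A : UnitaryConnection h) (P : Subbundle h) (s : Sec F E) (x : M)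
    (v : Tan x) : E x :=
  A.toFun (P.apply s) x v - P.proj x (A.toFun (P.apply s) x v)

/-- The second fundamental form along a vector field, as a section. -/
def UnitaryConnection.secondFormSec (A : UnitaryConnection h) (P : Subbundle h) (X : VField M)
    (s : Sec F E) : Sec F E :=
  A.nabla X (P.apply s) - P.apply (A.nabla X (P.apply s))

lemma Subbundle.apply_apply (P : Subbundle h) (s : Sec F E) : P.apply (P.apply s) = P.apply s := by
  ext x
  exact P.idem x (s x)

lemma UnitaryConnection.proj_secondForm (A : UnitaryConnection h) (P : Subbundle h) (s : Sec F E)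
    (x : M) (v : Tan x) : P.proj x (A.secondForm P s x v) = 0 := by
  rw [secondForm, _root_.map_sub, P.idem, sub_self]

lemma UnitaryConnection.hermitian_of_orthogonal (A : UnitaryConnection h) {s t : Sec F E}
    (hst : ∀ y, h.toFun y (s y) (t y) = 0) (x : M) (v : Tan x) :
    h.toFun x (s x) (A.toFun t x v) = - h.toFun x (A.toFun s x v) (t x) := by
  have h1 := A.unitary s t x v
  rw [dfun_eq_zero_of_eventuallyEq_const (Eventually.of_forall hst)] at h1
  linear_combination -h1

/-- The covariant derivative of a section `t` of the orthogonal complement of `P` has its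
component in `P` given by the adjoint of the second fundamental form. -/
lemma UnitaryConnection.hermitian_proj_of_orthogonal (A : UnitaryConnection h) (P : Subbundle h)
    {s t : Sec F E} (ht : ∀ y, P.proj y (t y) = 0) (x : M) (v : Tan x) :
    h.toFun x (s x) (P.proj x (A.toFun t x v)) = - h.toFun x (A.secondForm P s x v) (t x) := by
  rw [← P.selfAdjoint]
  have h1 := A.hermitian_of_orthogonal (s := P.apply s) (t := t) (fun y => by
    change h.toFun y (P.proj y (s y)) (t y) = 0
    rw [P.selfAdjoint, ht, _root_.map_zero]) x v
  refine h1.trans ?_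
  rw [secondForm, _root_.map_sub, LinearMap.sub_apply, P.selfAdjoint, ht, _root_.map_zero, sub_zero]

/-- The Gauss equation, when the curvature of `A` is the scalar 2-form `κ`. -/
lemma UnitaryConnection.curvatureOn_eq {A : UnitaryConnection h} {P : Subbundle h}
    {R : ∀ x : M, Tan x → Tan x → E x →ₗ[ℂ] E x} {κ : ∀ x : M, Tan x → Tan x → ℂ}
    (hA : A.IsCurvature fun x v w => κ x v w • LinearMap.id) (hR : A.IsCurvatureOn P R)
    (X Y : VField M) (s : Sec F E) (x : M) :
    R x (X x) (Y x) (s x) = κ x (X x) (Y x) • P.proj x (s x)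
      - P.proj x (A.toFun (A.secondFormSec P Y s) x (X x))
      + P.proj x (A.toFun (A.secondFormSec P X s) x (Y x)) := by
  have h1 : κ x (X x) (Y x) • P.proj x (s x) =
      A.toFun (A.nabla Y (P.apply s)) x (X x) - A.toFun (A.nabla X (P.apply s)) x (Y x)
        - A.toFun (P.apply s) x (VectorField.mlieBracket 𝓘(ℝ, ℂ) X Y x) :=
    hA X Y (P.apply s) x
  have hcov : ∀ X Y : VField M, A.covOn P X (A.covOn P Y s) x =
      P.proj x (A.toFun (A.nabla Y (P.apply s)) x (X x)) -
        P.proj x (A.toFun (A.secondFormSec P Y s) x (X x)) := by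
    intro X Y
    change P.proj x (A.toFun (P.apply (P.apply (A.nabla Y (P.apply s)))) x (X x)) = _
    rw [P.apply_apply, ← _root_.map_sub, ← LinearMap.sub_apply, ← A.toFun_sub, secondFormSec,
      sub_sub_cancel]
  have h2 := congrArg (P.proj x) h1
  simp only [_root_.map_smul, _root_.map_sub, P.idem] at h2
  rw [hR X Y s x, hcov, hcov, h2]
  abel

lemma DolbeaultOperator.IsHolomorphicSubbundle.secondForm_J {A : UnitaryConnection h}
    {P : Subbundle h} (hP : A.dolbeault.IsHolomorphicSubbundle P) (s : Sec F E) (x : M)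
    (v : Tan x) : A.secondForm P s x (J x v) = Complex.I • A.secondForm P s x v := by
  have h1 := hP s x v
  rw [A.dolbeault_apply, _root_.map_smul] at h1
  have h2 := smul_right_injective (E x) (by norm_num : (1 / 2 : ℂ) ≠ 0) h1
  simp only [_root_.map_add, _root_.map_smul] at h2
  have h3 : A.secondForm P s x v + Complex.I • A.secondForm P s x (J x v) = 0 := by
    simp only [UnitaryConnection.secondForm, smul_sub]
    rw [← sub_eq_zero, ← neg_eq_zero] at h2
    rw [← h2]
    abel
  have h4 := congrArg (fun e => Complex.I • e) h3
  simp only [smul_add, smul_smul, Complex.I_mul_I, neg_smul, one_smul, smul_zero] at h4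
  rw [← sub_eq_add_neg, sub_eq_zero] at h4
  exact h4.symm

/-- Curvature decreases in holomorphic subbundles: with `B (J v) = i B v`, both terms of the Gauss
equation involving the second fundamental form `B` contribute `i ⟪B v, B v⟫`. -/
lemma UnitaryConnection.hermitian_curvatureOn {A : UnitaryConnection h} {P : Subbundle h}
    {R : ∀ x : M, Tan x → Tan x → E x →ₗ[ℂ] E x} {κ : ∀ x : M, Tan x → Tan x → ℂ}
    (hA : A.IsCurvature fun x v w => κ x v w • LinearMap.id) (hR : A.IsCurvatureOn P R)
    (hP : A.dolbeault.IsHolomorphicSubbundle P) (s s' : Sec F E) (x : M) (v : Tan x) :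
    h.toFun x (s' x) (R x v (J x v) (s x)) = κ x v (J x v) * h.toFun x (s' x) (P.proj x (s x))
      + 2 * Complex.I * h.toFun x (A.secondForm P s' x v) (A.secondForm P s x v) := by
  obtain ⟨X, rfl⟩ := exists_vfield_apply_eq x v
  have h1 := A.curvatureOn_eq hA hR X X.rotate s x
  have h2 : ∀ (X Y : VField M), h.toFun x (s' x)
      (P.proj x (A.toFun (A.secondFormSec P Y s) x (X x))) =
        - h.toFun x (A.secondForm P s' x (X x)) (A.secondForm P s x (Y x)) := fun X Y =>
    A.hermitian_proj_of_orthogonal P (t := A.secondFormSec P Y s)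
      (fun y => A.proj_secondForm P s y (Y y)) x (X x)
  have hXJ : X.rotate x = J x (X x) := rfl
  rw [← hXJ, h1, _root_.map_add, _root_.map_sub, _root_.map_smul, h2, h2, hXJ,
    hP.secondForm_J, hP.secondForm_J]
  simp only [LinearMap.map_smulₛₗ, LinearMap.smul_apply, RingHom.id_apply, Complex.conj_I,
    smul_eq_mul]
  ring

/-- The curvature of a subbundle is only characterized pointwise; the Gauss equation exhibits its
value on smooth vector fields as a smooth endomorphism field. -/
lemma continuous_trace_curvatureOn {A : UnitaryConnection h} {P : Subbundle h}
    {R : ∀ x : M, Tan x → Tan x → E x →ₗ[ℂ] E x} {κ : ∀ x : M, Tan x → Tan x → ℂ}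
    (hA : A.IsCurvature fun x v w => κ x v w • LinearMap.id) (hR : A.IsCurvatureOn P R)
    (hκ : ∀ X Y : VField M, ContMDiff 𝓘(ℝ, ℂ) 𝓘(ℝ, ℂ) ∞ fun x => κ x (X x) (Y x))
    (X Y : VField M) :
    Continuous fun x => LinearMap.trace ℂ (E x) (R x (X x) (Y x)) := by
  refine (contMDiff_trace (F := F) (ψ := fun x => R x (X x) (Y x)) fun s => ?_).continuous
  have h1 : (fun x => TotalSpace.mk' F x (R x (X x) (Y x) (s x))) = fun x => TotalSpace.mk' F x
      ((fmul ⟨_, hκ X Y⟩ (P.apply s) - P.apply (A.nabla X (A.secondFormSec P Y s))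
        + P.apply (A.nabla Y (A.secondFormSec P X s)) : Sec F E) x) := by
    funext x
    rw [A.curvatureOn_eq hA hR X Y s x]
    rfl
  rw [SmoothSec, h1]
  exact ContMDiffSection.contMDiff _

/-! ### Degrees of holomorphic subbundles of Yang-Mills connections -/

/-- A subbundle with vanishing second fundamental form is parallel. -/
lemma UnitaryConnection.isParallel_proj {A : UnitaryConnection h} {P : Subbundle h}
    (hP : ∀ s x v, A.secondForm P s x v = 0) : A.IsParallel P.proj := by
  refine ⟨P.smooth, fun s x v => ?_⟩
  have h1 : P.proj x (A.toFun (s - P.apply s) x v) = 0 := by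
    refine HermitianMetric.eq_zero (h := h) fun e => ?_
    obtain ⟨t, rfl⟩ := exists_sec_apply_eq (F := F) x e
    rw [← h.conj_symm, A.hermitian_proj_of_orthogonal P (t := s - P.apply s) (fun y => ?_), hP]
    · simp
    · change P.proj y (s y - P.proj y (s y)) = 0
      rw [_root_.map_sub, P.idem, sub_self]
  rw [A.toFun_sub, LinearMap.sub_apply, _root_.map_sub, sub_eq_zero] at h1
  rw [h1]
  exact sub_eq_zero.1 (hP s x v)

lemma UnitaryConnection.IsParallel.secondForm_eq_zero {A : UnitaryConnection h} {P : Subbundle h}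
    (hP : A.IsParallel P.proj) (s : Sec F E) (x : M) (v : Tan x) : A.secondForm P s x v = 0 := by
  have h1 : ∀ s : Sec F E, A.toFun (P.apply s) x v = P.proj x (A.toFun s x v) :=
    fun s => hP.comm s x v
  rw [secondForm, ← h1, P.apply_apply, sub_self]

lemma UnitaryConnection.IsParallel.isHolomorphicSubbundle {A : UnitaryConnection h}
    {P : Subbundle h} (hP : A.IsParallel P.proj) : A.dolbeault.IsHolomorphicSubbundle P := by
  intro s x v
  have h1 : ∀ v, P.proj x (A.toFun (P.apply s) x v) = A.toFun (P.apply s) x v := fun v =>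
    (sub_eq_zero.1 (hP.secondForm_eq_zero s x v)).symm
  rw [A.dolbeault_apply, _root_.map_smul, _root_.map_add, _root_.map_smul, h1, h1]

lemma Subbundle.trace_proj (P : Subbundle h) (x : M) :
    LinearMap.trace ℂ (E x) (P.proj x) = P.rank := by
  have := finiteDimensional_fiber (F := F) (E := E) x
  have h1 : IsIdempotentElem (P.proj x) := LinearMap.ext fun e => P.idem x e
  have h2 := LinearMap.IsProj.trace (LinearMap.IsIdempotentElem.isProj_range _ h1)
  rw [h2, P.finrank_eq]

/-- The degree of a holomorphic subbundle `P` of a Yang-Mills connection is at most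
`rank P * d / r`, with equality if and only if `P` is parallel: the difference is the integral of the
squared norm of the second fundamental form. -/
theorem degree_of_yangMills {A : UnitaryConnection h} {g : CompatibleMetric M}
    (hg : g.UnitVolume) {d : ℤ} (hA : A.IsYangMills g d) {P : Subbundle h}
    (hP : A.dolbeault.IsHolomorphicSubbundle P) {δ : ℝ} (hδ : A.dolbeault.SubbundleDegree P δ) :
    δ ≤ P.rank * (d / Module.finrank ℂ F) ∧
      (δ = P.rank * (d / Module.finrank ℂ F) ↔ A.IsParallel P.proj) := by
  obtain ⟨A', R, hA', hR, hδR⟩ := hδ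
  obtain rfl := UnitaryConnection.dolbeault_injective hA'
  set r : ℂ := (Module.finrank ℂ F : ℂ)
  set κ : ∀ x : M, Tan x → Tan x → ℂ := fun x v w =>
    -(2 * Real.pi * Complex.I * ((d : ℂ) / r)) * (g.vol x v w : ℂ)
  have hAκ : A'.IsCurvature fun x v w => κ x v w • LinearMap.id := hA
  have hvolsm : ∀ X Y : VField M, ContMDiff 𝓘(ℝ, ℂ) 𝓘(ℝ, ℂ) ∞ fun x =>
      (g.vol x (X x) (Y x) : ℂ) := fun X Y =>
    Complex.ofRealCLM.contDiff.comp_contMDiff (g.smooth X.rotate Y)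
  have hκsm : ∀ X Y : VField M, ContMDiff 𝓘(ℝ, ℂ) 𝓘(ℝ, ℂ) ∞ fun x => κ x (X x) (Y x) :=
    fun X Y => ContDiff.comp_contMDiff
      (g := fun z : ℂ => -(2 * Real.pi * Complex.I * ((d : ℂ) / r)) * z) (by fun_prop) (hvolsm X Y)
  -- `θ x v (J v)` is the squared norm of the second fundamental form at `v`, and `tr R` differs from
  -- the multiple `rank P * κ` of the volume form by `2 i θ`
  let θ : ∀ x : M, Tan x → Tan x → ℂ := fun x v w =>
    (1 / (2 * Complex.I)) * (LinearMap.trace ℂ (E x) (R x v w) - P.rank * κ x v w)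
  have hvolc : ContinuousForm fun (x : M) v w => (g.vol x v w : ℂ) :=
    continuousForm_of_vfield fun X Y => (hvolsm X Y).continuous
  have hθc : ContinuousForm θ := continuousForm_of_vfield fun X Y =>
    continuous_const.mul ((continuous_trace_curvatureOn hAκ hR hκsm X Y).sub
      (continuous_const.mul (hκsm X Y).continuous))
  have hgram : ∀ x v, ∃ r : ℝ, 0 ≤ r ∧ θ x v (J x v) = r ∧
      (r = 0 ↔ ∀ s : Sec F E, A'.secondForm P s x v = 0) := by
    intro x v
    have := finiteDimensional_fiber (F := F) (E := E) x
    choose sec hsec using fun e : E x => exists_sec_apply_eq (F := F) x e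
    let T : E x →ₗ[ℂ] E x := (1 / (2 * Complex.I)) • (R x v (J x v) - κ x v (J x v) • P.proj x)
    have hT : ∀ (s s' : Sec F E) (e e' : E x), s x = e → s' x = e' → h.toFun x e' (T e) =
        h.toFun x (A'.secondForm P s' x v) (A'.secondForm P s x v) := by
      rintro s s' _ _ rfl rfl
      simp only [T, LinearMap.smul_apply, LinearMap.sub_apply, _root_.map_smul, _root_.map_sub,
        smul_eq_mul]
      rw [A'.hermitian_curvatureOn hAκ hR hP]
      field_simp [Complex.I_ne_zero]
      ring
    obtain ⟨r, hr0, hr, hr1⟩ := trace_gram (h.conj_symm x) (h.pos x)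
      (fun e => A'.secondForm P (sec e) x v) T
      (fun e' e => hT _ _ e e' (hsec e) (hsec e'))
    refine ⟨r, hr0, ?_, fun h0 s => ?_, fun h0 => ?_⟩
    · rw [← hr]
      simp only [T, θ, _root_.map_smul, _root_.map_sub, smul_eq_mul, P.trace_proj]
      ring
    · have h1 : T (s x) = 0 := eq_zero_of_hermitian_self (h.pos x) (by
        rw [hT s (sec (T (s x))) _ _ rfl (hsec _), hr1 h0, _root_.map_zero,
          LinearMap.zero_apply])
      exact eq_zero_of_hermitian_self (h.pos x) (by
        rw [← hT s s _ _ rfl rfl, h1, _root_.map_zero])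
    · have h1 : T = 0 := LinearMap.ext fun e => eq_zero_of_hermitian_self (h.pos x) (by
        rw [hT (sec e) (sec (T e)) _ _ (hsec _) (hsec _), h0, _root_.map_zero,
          LinearMap.zero_apply])
      rw [h1, _root_.map_zero] at hr
      exact_mod_cast hr.symm
  obtain ⟨I, hI0, hI, hI1⟩ := integralForm_nonneg hθc fun x v =>
    (hgram x v).imp fun r hr => ⟨hr.1, hr.2.1⟩
  have htr : (fun x v w => LinearMap.trace ℂ (E x) (R x v w)) = fun (x : M) v w =>
      (P.rank * -(2 * Real.pi * Complex.I * ((d : ℂ) / r))) * (g.vol x v w : ℂ)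
        + (2 * Complex.I) * θ x v w := by
    funext x v w
    simp only [θ, κ]
    field_simp [Complex.I_ne_zero]
    ring
  have hmain : δ = P.rank * (d / Module.finrank ℂ F) - I / Real.pi := by
    rw [htr, integralForm_linear hvolc hθc, hg, hI] at hδR
    have hpi : (Real.pi : ℂ) ≠ 0 := by exact_mod_cast Real.pi_ne_zero
    have h1 : (δ : ℂ) = P.rank * (d / r) - I / Real.pi := by
      rw [hδR]
      generalize (d : ℂ) / r = q
      have h2 : Complex.I / (2 * Real.pi) * (P.rank * -(2 * Real.pi * Complex.I * q) * 1 +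
          2 * Complex.I * I) = -(Complex.I ^ 2) * (P.rank * q - I / Real.pi) := by
        field_simp
        ring
      rw [h2, Complex.I_sq]
      ring
    have h2 : ((P.rank * (d / Module.finrank ℂ F) - I / Real.pi : ℝ) : ℂ) =
        P.rank * (d / r) - I / Real.pi := by
      push_cast
      rfl
    exact_mod_cast h1.trans h2.symm
  have hIpi : 0 ≤ I / Real.pi := div_nonneg hI0 Real.pi_pos.le
  refine ⟨by linarith, fun heq => ?_, fun hpar => ?_⟩
  · have hI00 : I = 0 := by
      have : I / Real.pi = 0 := by linarith
      simpa [Real.pi_ne_zero] using this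
    refine A'.isParallel_proj fun s x v => ?_
    obtain ⟨w, hw, hθw⟩ := hI1 hI00 x
    obtain ⟨ρ, -, hρ, hρ0⟩ := hgram x w
    have hzero := hρ0.1 (by rw [hθw] at hρ; exact_mod_cast hρ.symm) s
    have hzeroJ : A'.secondForm P s x (J x w) = 0 := by rw [hP.secondForm_J, hzero, smul_zero]
    -- `w` and `J w` span the tangent plane
    have hspan : ∃ a b : ℝ, v = a • w + b • J x w := by
      have key : ∀ v w : ℂ, w ≠ 0 → ∃ a b : ℝ, v = a • w + b • (Complex.I * w) := by
        intro v w hw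
        refine ⟨(v / w).re, (v / w).im, ?_⟩
        have h1 := Complex.re_add_im (v / w)
        rw [Complex.real_smul, Complex.real_smul]
        calc v = (v / w) * w := by field_simp
          _ = ((v / w).re + (v / w).im * Complex.I) * w := by rw [h1]
          _ = _ := by ring
      exact key v w hw
    obtain ⟨a, b, rfl⟩ := hspan
    let L : Tan x →ₗ[ℝ] E x := A'.toFun (P.apply s) x -
      ((P.proj x).restrictScalars ℝ) ∘ₗ A'.toFun (P.apply s) x
    have hL : ∀ v, A'.secondForm P s x v = L v := fun v => rfl
    rw [hL] at hzero hzeroJ ⊢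
    rw [L.map_add, L.map_smul, L.map_smul, hzero, hzeroJ, smul_zero, smul_zero, add_zero]
  · have hI00 : I = 0 := by
      rw [← Complex.ofReal_eq_zero, ← hI]
      refine integralForm_eq_zero fun x v => ?_
      obtain ⟨ρ, -, hρ, hρ0⟩ := hgram x v
      rw [hρ, hρ0.2 fun s => hpar.secondForm_eq_zero s x v, Complex.ofReal_zero]
    rw [hmain, hI00, zero_div, sub_zero]

end Curvature

/-! ### Yang-Mills connections are polystable -/

section Polystable

variable {M : Type*} [TopologicalSpace M] [T2Space M] [CompactSpace M] [ChartedSpace ℂ M]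
  [IsManifold 𝓘(ℂ) ω M]
  {F : Type*} [NormedAddCommGroup F] [NormedSpace ℂ F] [FiniteDimensional ℂ F]
  {E : M → Type*} [TopologicalSpace (TotalSpace F E)] [∀ x, TopologicalSpace (E x)]
  [FiberBundle F E] [∀ x, AddCommGroup (E x)] [∀ x, Module ℂ (E x)]
  [VectorBundle ℂ F E] [ContMDiffVectorBundle ∞ F E 𝓘(ℝ, ℂ)]
  {h : HermitianMetric F E}

lemma UnitaryConnection.isParallel_whole (A : UnitaryConnection h) :
    A.IsParallel (Subbundle.whole h).proj := ⟨(Subbundle.whole h).smooth, fun _ _ _ => rfl⟩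

variable (h) in
/-- The zero subbundle. -/
def Subbundle.zero : Subbundle h where
  proj _ := 0
  idem _ _ := rfl
  selfAdjoint x e e' := by
    rw [LinearMap.zero_apply, LinearMap.zero_apply, LinearMap.map_zero, LinearMap.map_zero,
      LinearMap.zero_apply]
  smooth s := (0 : Sec F E).contMDiff
  rank := 0
  finrank_eq x := by rw [LinearMap.range_zero, finrank_bot]

lemma UnitaryConnection.isParallel_zero (A : UnitaryConnection h) :
    A.IsParallel (Subbundle.zero h).proj :=
  ⟨(Subbundle.zero h).smooth, fun _ x v => congrArg (fun L => L v) (A.toFun_zero x)⟩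

lemma Subbundle.proj_eq_zero_of_rank {P : Subbundle h} (hP : P.rank = 0) (x : M) :
    P.proj x = 0 := by
  have := finiteDimensional_fiber (F := F) (E := E) x
  have h1 := P.finrank_eq x
  rw [hP, Submodule.finrank_eq_zero] at h1
  exact LinearMap.range_eq_bot.1 h1

lemma Subbundle.proj_eq_id_of_rank {P : Subbundle h} (hP : P.rank = Module.finrank ℂ F) (x : M) :
    P.proj x = LinearMap.id := by
  have := finiteDimensional_fiber (F := F) (E := E) x
  have h1 := P.finrank_eq x
  have h2 : Module.finrank ℂ (E x) = Module.finrank ℂ F :=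
    ((trivializationAt F E x).continuousLinearEquivAt ℂ x
      (mem_baseSet_trivializationAt F E x)).toLinearEquiv.finrank_eq
  have h3 : LinearMap.range (P.proj x) = ⊤ :=
    Submodule.eq_top_of_finrank_eq (h1.trans (hP.trans h2.symm))
  ext e
  obtain ⟨e', rfl⟩ := LinearMap.range_eq_top.1 h3 e
  exact P.idem x e'

lemma degree_whole_of_yangMills {A : UnitaryConnection h} {g : CompatibleMetric M}
    (hg : g.UnitVolume) (hr : 1 ≤ Module.finrank ℂ F) {d : ℤ} (hA : A.IsYangMills g d) {δ : ℝ}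
    (hδ : A.dolbeault.SubbundleDegree (Subbundle.whole h) δ) : δ = d := by
  have h1 := (degree_of_yangMills hg hA A.isParallel_whole.isHolomorphicSubbundle hδ).2.2
    A.isParallel_whole
  have hr' : (Module.finrank ℂ F : ℝ) ≠ 0 := by positivity
  rw [h1]
  change (Module.finrank ℂ F : ℝ) * (d / Module.finrank ℂ F) = d
  field_simp

lemma isSemistable_of_yangMills {A : UnitaryConnection h} {g : CompatibleMetric M}
    (hg : g.UnitVolume) (hr : 1 ≤ Module.finrank ℂ F) {d : ℤ} (hA : A.IsYangMills g d) :
    A.dolbeault.IsSemistable h := by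
  intro P hP h0 _ δ δE hδ hδE
  rw [degree_whole_of_yangMills hg hr hA hδE, div_le_iff₀ (by exact_mod_cast h0), mul_comm]
  exact (degree_of_yangMills hg hA hP hδ).1

/-- Every parallel subbundle has a finite filtration by parallel subbundles which cannot be
refined. -/
lemma UnitaryConnection.exists_parallel_filtration (A : UnitaryConnection h) (Q : Subbundle h)
    (hQ : A.IsParallel Q.proj) :
    ∃ (n : ℕ) (P : ℕ → Subbundle h), (∀ i, A.IsParallel (P i).proj) ∧ (P 0).rank = 0 ∧
      P n = Q ∧ ∀ i < n, (P i).Le (P (i + 1)) ∧ (P i).rank < (P (i + 1)).rank ∧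
        ∀ H : Subbundle h, A.IsParallel H.proj → (P i).Le H → H.Le (P (i + 1)) →
          (P i).rank < H.rank → H.rank < (P (i + 1)).rank → False := by
  induction hk : Q.rank using Nat.strong_induction_on generalizing Q with
  | _ k ih =>
    obtain rfl | hpos := Nat.eq_zero_or_pos k
    · exact ⟨0, fun _ => Q, fun _ => hQ, hk, rfl, fun i hi => absurd hi (Nat.not_lt_zero i)⟩
    -- a proper parallel subbundle of maximal rank
    let S : Set ℕ := {m | m < k ∧ ∃ H : Subbundle h, A.IsParallel H.proj ∧ H.Le Q ∧ H.rank = m}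
    have hS0 : S.Nonempty := ⟨0, hpos, Subbundle.zero h, A.isParallel_zero, fun x => by
      change LinearMap.range (0 : E x →ₗ[ℂ] E x) ≤ _
      rw [LinearMap.range_zero]
      exact bot_le, rfl⟩
    have hSb : BddAbove S := ⟨k, fun m hm => hm.1.le⟩
    obtain ⟨hlt, H, hH, hHQ, hHr⟩ := Nat.sSup_mem hS0 hSb
    obtain ⟨n, P, hP, hP0, hPn, hstep⟩ := ih _ hlt H hH hHr
    have hlow : ∀ i ≤ n, (if i ≤ n then P i else Q) = P i := fun i hi => if_pos hi
    have htop : (if n + 1 ≤ n then P (n + 1) else Q) = Q := if_neg (by omega)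
    refine ⟨n + 1, fun i => if i ≤ n then P i else Q, fun i => ?_, ?_, htop, fun i hi => ?_⟩
    · dsimp only
      split_ifs
      exacts [hP i, hQ]
    · dsimp only
      rw [hlow 0 n.zero_le, hP0]
    · dsimp only
      obtain hi' | rfl := (Nat.lt_succ_iff_lt_or_eq).1 hi
      · rw [hlow i hi'.le, hlow (i + 1) hi']
        exact hstep i hi'
      · rw [hlow i le_rfl, htop, hPn]
        refine ⟨hHQ, by rw [hHr, hk]; exact hlt, fun H' hH' _ hle h1 h2 => ?_⟩
        have := le_csSup hSb (show H'.rank ∈ S from ⟨hk ▸ h2, H', hH', hle, rfl⟩)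
        omega

/-- A maximal filtration by parallel subbundles is a Jordan-Hölder filtration: a holomorphic
subbundle of an intermediate rank is not parallel, so its degree is strictly smaller than that
prescribed by the slope of `E`. -/
lemma exists_jordanHolder_of_yangMills {A : UnitaryConnection h} {g : CompatibleMetric M}
    (hg : g.UnitVolume) (hr : 1 ≤ Module.finrank ℂ F) {d : ℤ} (hA : A.IsYangMills g d) :
    ∃ (n : ℕ) (P : ℕ → Subbundle h), A.dolbeault.IsJordanHolder n P ∧
      ∀ i, A.IsParallel (P i).proj := by
  obtain ⟨n, P, hP, hP0, hPn, hstep⟩ := A.exists_parallel_filtration _ A.isParallel_whole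
  have hdeg : ∀ {Q : Subbundle h} {δ : ℝ}, A.IsParallel Q.proj →
      A.dolbeault.SubbundleDegree Q δ → δ = Q.rank * (d / Module.finrank ℂ F) := fun hQ hδ =>
    (degree_of_yangMills hg hA hQ.isHolomorphicSubbundle hδ).2.2 hQ
  have hquot : ∀ i < n, ∀ δP δQ : ℝ, A.dolbeault.SubbundleDegree (P i) δP →
      A.dolbeault.SubbundleDegree (P (i + 1)) δQ →
      (δQ - δP) / (((P (i + 1)).rank : ℝ) - (P i).rank) = d / Module.finrank ℂ F := by
    intro i hi δP δQ hδP hδQ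
    have h1 : ((P i).rank : ℝ) < (P (i + 1)).rank := by exact_mod_cast (hstep i hi).2.1
    have h2 : ((P (i + 1)).rank : ℝ) - (P i).rank ≠ 0 := by linarith
    rw [hdeg (hP i) hδP, hdeg (hP (i + 1)) hδQ, ← sub_mul, mul_div_right_comm, div_self h2,
      one_mul]
  refine ⟨n, P, ⟨fun i _ => (hP i).isHolomorphicSubbundle, hP0, by rw [hPn]; rfl,
    fun i hi => (hstep i hi).1, fun i hi => ⟨(hstep i hi).2.1, ?_⟩, fun i hi δP δQ δE hP' hQ' hE' =>
      ?_⟩, hP⟩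
  · intro H hH hPH hHP hr1 hr2 δP δH δQ hδP hδH hδQ
    obtain ⟨hle, heq⟩ := degree_of_yangMills hg hA hH hδH
    have hne : δH ≠ H.rank * (d / Module.finrank ℂ F) := fun hEq =>
      (hstep i hi).2.2 H (heq.1 hEq) hPH hHP hr1 hr2
    rw [hquot i hi δP δQ hδP hδQ, div_lt_iff₀ (by
      rw [sub_pos]
      exact_mod_cast hr1), hdeg (hP i) hδP]
    have := lt_of_le_of_ne hle hne
    linarith
  · rw [hquot i hi δP δQ hP' hQ', degree_whole_of_yangMills hg hr hA hE']

lemma UnitaryConnection.IsParallel.dolbeault_apply_comm {A : UnitaryConnection h} {P : Subbundle h}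
    (hP : A.IsParallel P.proj) (s : Sec F E) (x : M) (v : Tan x) :
    A.dolbeault.toFun (P.apply s) x v = P.proj x (A.dolbeault.toFun s x v) := by
  have h1 : ∀ v, A.toFun (P.apply s) x v = P.proj x (A.toFun s x v) := fun v => hP.comm s x v
  rw [A.dolbeault_apply, A.dolbeault_apply, h1, h1]
  simp only [_root_.map_smul, _root_.map_add]

/-- A filtration by parallel subbundles splits holomorphically. -/
lemma graded_eq_of_parallel {A : UnitaryConnection h} {n : ℕ} {P : ℕ → Subbundle h}
    (hJ : A.dolbeault.IsJordanHolder n P) (hP : ∀ i, A.IsParallel (P i).proj) (s : Sec F E) (x : M)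
    (v : Tan x) : A.dolbeault.graded n P s x v = A.dolbeault.toFun s x v := by
  have hterm : ∀ i ∈ Finset.range n,
      (P (i + 1)).proj x (A.dolbeault.toFun (gradedPart P i s) x v) -
        (P i).proj x (A.dolbeault.toFun (gradedPart P i s) x v) =
      (P (i + 1)).proj x (A.dolbeault.toFun s x v) - (P i).proj x (A.dolbeault.toFun s x v) := by
    intro i hi
    have hle := hJ.le i (Finset.mem_range.1 hi)
    have h1 : ∀ y (e : E y), (P (i + 1)).proj y ((P i).proj y e) = (P i).proj y e := by
      intro y e
      obtain ⟨e', he'⟩ := hle y ⟨e, rfl⟩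
      rw [← he', (P (i + 1)).idem]
    have h2 : ∀ y (e : E y), (P i).proj y ((P (i + 1)).proj y e) = (P i).proj y e := by
      intro y e
      rw [← sub_eq_zero, ← _root_.map_sub]
      refine HermitianMetric.eq_zero (h := h) fun e' => ?_
      rw [(P i).selfAdjoint, _root_.map_sub, LinearMap.sub_apply, (P (i + 1)).selfAdjoint, h1,
        sub_self]
    have h3 : (P (i + 1)).apply (gradedPart P i s) = gradedPart P i s := by
      ext y
      change (P (i + 1)).proj y ((P (i + 1)).proj y (s y) - (P i).proj y (s y)) =
        (P (i + 1)).proj y (s y) - (P i).proj y (s y)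
      rw [_root_.map_sub, (P (i + 1)).idem, h1]
    have h4 : (P i).apply (gradedPart P i s) = (P i).apply 0 := by
      ext y
      change (P i).proj y ((P (i + 1)).proj y (s y) - (P i).proj y (s y)) = (P i).proj y 0
      rw [_root_.map_sub, (P i).idem, h2, sub_self, _root_.map_zero]
    have h5 : A.dolbeault.toFun (gradedPart P i s) x v =
        A.dolbeault.toFun ((P (i + 1)).apply s) x v - A.dolbeault.toFun ((P i).apply s) x v := by
      simp only [A.dolbeault_apply, gradedPart, A.toFun_sub, LinearMap.sub_apply, smul_sub,
        smul_add]
      abel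
    rw [← (hP (i + 1)).dolbeault_apply_comm, ← (hP i).dolbeault_apply_comm, h3, h4, h5,
      (hP (i + 1)).dolbeault_apply_comm, (hP i).dolbeault_apply_comm,
      (hP i).dolbeault_apply_comm]
    have h6 : A.dolbeault.toFun 0 x v = 0 := by
      simp [A.dolbeault_apply, A.toFun_zero]
    rw [h6, _root_.map_zero, sub_zero]
  rw [DolbeaultOperator.graded, Finset.sum_congr rfl hterm,
    Finset.sum_range_sub (fun i => (P i).proj x (A.dolbeault.toFun s x v)),
    Subbundle.proj_eq_id_of_rank hJ.top, Subbundle.proj_eq_zero_of_rank hJ.bot]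
  simp

variable {σ : AntiholInvolution M} {τ : RealStructure F E σ}

lemma UnitaryConnection.IsReal.dolbeault {A : UnitaryConnection h} (hA : A.IsReal τ) :
    A.dolbeault.IsReal τ := by
  intro s x v
  have hJ : J (σ.toFun x) (σ.tangent x v) = - σ.tangent x (J x v) := by
    have := σ.antihol x v
    rw [AntiholInvolution.tangent, AntiholInvolution.tangent, this, neg_neg]
  rw [A.dolbeault_apply, A.dolbeault_apply, hJ, LinearMap.map_neg, hA, hA]
  simp only [LinearMap.map_smulₛₗ, _root_.map_add, smul_neg, Complex.conj_I, neg_smul,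
    _root_.map_div₀, map_one, map_ofNat]

/-- The orbit of a real Yang-Mills connection is the modulus of a real semistable bundle, namely of
its own holomorphic bundle. -/
lemma mk_mem_realModuli {g : CompatibleMetric M}
    (hg : g.UnitVolume) (hr : 1 ≤ Module.finrank ℂ F) {d : ℤ} (A : RealYangMills h g d τ) :
    Quotient.mk (unitaryOrbits h g d) A.1 ∈ RealModuli h σ g d := by
  obtain ⟨n, P, hJ, hP⟩ := exists_jordanHolder_of_yangMills hg hr A.1.2
  exact ⟨A.1, rfl, A.1.1.dolbeault, isSemistable_of_yangMills hg hr A.1.2, ⟨τ, A.2.dolbeault⟩, n, P,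
    hJ, 1, fun s x v => (graded_eq_of_parallel hJ hP s x v).symm⟩

end Polystable

/-! ### Square roots of unitary operators -/

open Polynomial in
/-- A unitary operator `φ` has a unitary square root `p(φ)`, for a complex polynomial `p`: the
polynomial interpolates a square root function on the spectrum of `φ`. The adjoint of `p(φ)` is
`p̄(φ⁻¹)`. -/
lemma exists_polynomial_sqrt {V : Type*} [AddCommGroup V] [Module ℂ V] [FiniteDimensional ℂ V]
    {H : V →ₗ⋆[ℂ] V →ₗ[ℂ] ℂ} (hs : ∀ e e', starRingEnd ℂ (H e e') = H e' e)
    (hp : ∀ e, e ≠ 0 → 0 < (H e e).re) (φ : V ≃ₗ[ℂ] V)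
    (hφ : ∀ e e', H (φ e) (φ e') = H e e') :
    ∃ p : ℂ[X], aeval (φ : Module.End ℂ V) (p ^ 2) = (φ : Module.End ℂ V) ∧
      aeval (φ.symm : Module.End ℂ V) (p.map (starRingEnd ℂ)) *
        aeval (φ : Module.End ℂ V) p = 1 := by
  set f : Module.End ℂ V := (φ : Module.End ℂ V) with hf
  have hss : f.IsSemisimple := by
    let core := hermitianCore hs hp
    let _ : NormedAddCommGroup V := core.toNormedAddCommGroup
    let _ : InnerProductSpace ℂ V := InnerProductSpace.ofCore core.toCore
    refine Module.End.isSemisimple_iff.2 fun p hpi => ⟨pᗮ, ?_, ?_⟩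
    · rw [Module.End.mem_invtSubmodule] at hpi ⊢
      intro y hy x hx
      have hmap : p.map f = p := by
        refine Submodule.eq_of_le_of_finrank_eq (Submodule.map_le_iff_le_comap.2 hpi) ?_
        exact (φ.submoduleMap p).finrank_eq.symm
      rw [← hmap] at hx
      obtain ⟨x', hx', rfl⟩ := hx
      exact (hφ x' y).trans (hy x' hx')
    · exact p.isCompl_orthogonal
  have htop : ⨆ μ, f.eigenspace μ = ⊤ := by
    rw [← Module.End.iSup_maxGenEigenspace_eq_top f]
    exact iSup_congr fun μ => (hss.isFinitelySemisimple.maxGenEigenspace_eq_eigenspace μ).symm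
  have hext : ∀ g k : Module.End ℂ V,
      (∀ μ e, f.HasEigenvector μ e → g e = k e) → g = k := by
    intro g k hgk
    rw [← LinearMap.eqLocus_eq_top, eq_top_iff, ← htop]
    refine iSup_le fun μ e he => ?_
    by_cases h0 : e = 0
    · rw [h0]; exact zero_mem _
    · exact hgk μ e ⟨he, h0⟩
  have hunit : ∀ μ e, f.HasEigenvector μ e → starRingEnd ℂ μ * μ = 1 := by
    intro μ e he
    have h1 := hφ e e
    rw [show φ e = μ • e from he.apply_eq_smul] at h1
    simp only [LinearMap.map_smulₛₗ, LinearMap.smul_apply, RingHom.id_apply, smul_eq_mul] at h1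
    rw [mul_left_comm, ← mul_assoc] at h1
    have h2 : H e e ≠ 0 := fun h => he.2 (eq_zero_of_hermitian_self hp h)
    exact mul_right_cancel₀ h2 (h1.trans (one_mul _).symm)
  choose rt hrt using fun μ : ℂ => IsAlgClosed.exists_pow_nat_eq μ (n := 2) (by norm_num)
  let S := (Module.End.finite_hasEigenvalue f).toFinset
  let p := Lagrange.interpolate S id rt
  have hpe : ∀ μ e, f.HasEigenvector μ e → p.eval μ = rt μ := fun μ e he =>
    Lagrange.eval_interpolate_at_node rt (Function.injective_id.injOn)
      ((Module.End.finite_hasEigenvalue f).mem_toFinset.2 (Module.End.hasEigenvalue_of_hasEigenvector he))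
  refine ⟨p, hext _ _ fun μ e he => ?_, hext _ _ fun μ e he => ?_⟩
  · rw [Module.End.aeval_apply_of_hasEigenvector he, eval_pow, hpe μ e he, hrt, he.apply_eq_smul]
  · have hμ := hunit μ e he
    have hμ0 : μ ≠ 0 := right_ne_zero_of_mul_eq_one hμ
    have hinv : Module.End.HasEigenvector (φ.symm : Module.End ℂ V) (starRingEnd ℂ μ) e := by
      refine ⟨Module.End.mem_eigenspace_iff.2 ?_, he.2⟩
      change φ.symm e = _
      rw [LinearEquiv.symm_apply_eq, map_smul, show φ e = μ • e from he.apply_eq_smul, smul_smul,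
        hμ, one_smul]
    have hev : (p.map (starRingEnd ℂ)).eval (starRingEnd ℂ μ) = starRingEnd ℂ (rt μ) := by
      rw [eval_map, eval₂_hom, hpe μ e he]
    rw [Module.End.mul_apply, Module.End.aeval_apply_of_hasEigenvector he, map_smul,
      Module.End.aeval_apply_of_hasEigenvector hinv, hpe μ e he, hev, smul_smul,
      Module.End.one_apply, Complex.mul_conj]
    have h1 : Complex.normSq (rt μ) ^ 2 = 1 := by
      rw [← map_pow, hrt]
      have h2 := (Complex.normSq_eq_conj_mul_self (z := μ)).trans hμ
      exact_mod_cast h2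
    rw [(pow_eq_one_iff_of_nonneg (Complex.normSq_nonneg _) two_ne_zero).1 h1, Complex.ofReal_one, one_smul]

section Parallel

open Polynomial

variable {M : Type*} [TopologicalSpace M] [T2Space M] [CompactSpace M] [ChartedSpace ℂ M]
  [IsManifold 𝓘(ℂ) ω M]
  {F : Type*} [NormedAddCommGroup F] [NormedSpace ℂ F] [FiniteDimensional ℂ F]
  {E : M → Type*} [TopologicalSpace (TotalSpace F E)] [∀ x, TopologicalSpace (E x)]
  [FiberBundle F E] [∀ x, AddCommGroup (E x)] [∀ x, Module ℂ (E x)]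
  [VectorBundle ℂ F E] [ContMDiffVectorBundle ∞ F E 𝓘(ℝ, ℂ)]
  {h : HermitianMetric F E}

/-! ### The algebra of parallel endomorphisms -/

namespace UnitaryConnection.IsParallel

variable {A : UnitaryConnection h} {ψ ψ' : ∀ x, E x →ₗ[ℂ] E x}

lemma add (hψ : A.IsParallel ψ) (hψ' : A.IsParallel ψ') : A.IsParallel fun x => ψ x + ψ' x where
  smooth s := ((⟨_, hψ.smooth s⟩ + ⟨_, hψ'.smooth s⟩ : Sec F E)).contMDiff
  comm s x v := by
    have h1 := A.add ⟨_, hψ.smooth s⟩ ⟨_, hψ'.smooth s⟩ x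
    have h2 := congrArg (fun L => L v) h1
    rw [LinearMap.add_apply, ← hψ.comm, ← hψ'.comm]
    exact h2

lemma comp (hψ : A.IsParallel ψ) (hψ' : A.IsParallel ψ') : A.IsParallel fun x => ψ x * ψ' x where
  smooth s := hψ.smooth ⟨_, hψ'.smooth s⟩
  comm s x v := by
    rw [Module.End.mul_apply, ← hψ'.comm, ← hψ.comm]
    rfl

lemma algebraMap (a : ℂ) : A.IsParallel fun x => algebraMap ℂ (Module.End ℂ (E x)) a where
  smooth s := (fmul ⟨fun _ => a, contMDiff_const⟩ s).contMDiff
  comm s x v := by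
    have h1 := A.leibniz ⟨fun _ => a, contMDiff_const⟩ s x v
    have h2 : dfun (fun _ : M => a) x v = 0 :=
      dfun_eq_zero_of_eventuallyEq_const (Eventually.of_forall fun _ => rfl) v
    refine h1.trans ?_
    refine (congrArg (fun z => z • s x + a • A.toFun s x v) h2).trans ?_
    rw [zero_smul, zero_add]
    rfl

lemma aeval (hψ : A.IsParallel ψ) (p : ℂ[X]) : A.IsParallel fun x => aeval (ψ x) p := by
  induction p using Polynomial.induction_on with
  | C a => simpa only [aeval_C] using algebraMap a
  | add p q hp hq => simpa only [_root_.map_add] using hp.add hq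
  | monomial n a ih =>
    have h1 := ih.comp hψ
    have h2 : (fun x => Polynomial.aeval (ψ x) (C a * X ^ (n + 1))) =
        fun x => Polynomial.aeval (ψ x) (C a * X ^ n) * ψ x := by
      funext x
      rw [pow_succ, ← mul_assoc, map_mul, aeval_X]
    rw [h2]
    exact h1

end UnitaryConnection.IsParallel

/-- Elements of the stabilizer of a connection are parallel. -/
lemma isParallel_of_smul_eq {A : UnitaryConnection h} {u : unitaryGauge h} (hu : u • A = A) :
    A.IsParallel fun x => (u.1 x : E x →ₗ[ℂ] E x) := by
  refine ⟨u.2.1.1, fun s x v => ?_⟩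
  have h1 : (u • A).toFun (gaugeSec (toComplexGauge u) s) x v =
      A.toFun (gaugeSec (toComplexGauge u) s) x v := by rw [hu]
  have h2 : gaugeSec (toComplexGauge u)⁻¹ (gaugeSec (toComplexGauge u) s) = s := by
    ext y
    exact (u.1 y).symm_apply_apply (s y)
  refine h1.symm.trans ?_
  change u.1 x (A.toFun (gaugeSec (toComplexGauge u)⁻¹ (gaugeSec (toComplexGauge u) s)) x v) = _
  rw [h2]
  rfl

lemma smul_eq_of_isParallel {A : UnitaryConnection h} {u : unitaryGauge h}
    (hu : A.IsParallel fun x => (u.1 x : E x →ₗ[ℂ] E x)) : u • A = A := by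
  ext s x v
  change u.1 x (A.toFun (gaugeSec (toComplexGauge u)⁻¹ s) x v) = _
  have h1 := hu.comm (gaugeSec (toComplexGauge u)⁻¹ s) x v
  refine h1.symm.trans ?_
  congr 2
  ext y
  exact (u.1 y).apply_symm_apply (s y)

/-- The adjoint of `p(f)` is `p̄(f*)`. -/
lemma aeval_adjoint {V : Type*} [AddCommGroup V] [Module ℂ V] {H : V →ₗ⋆[ℂ] V →ₗ[ℂ] ℂ}
    {f f' : Module.End ℂ V} (hf : ∀ e e', H (f e) e' = H e (f' e')) (p : ℂ[X]) (e e' : V) :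
    H (aeval f p e) e' = H e (aeval f' (p.map (starRingEnd ℂ)) e') := by
  induction p using Polynomial.induction_on generalizing e with
  | C a =>
    simp only [aeval_C, Polynomial.map_C, Module.algebraMap_end_apply, LinearMap.map_smulₛₗ,
      LinearMap.smul_apply, RingHom.id_apply]
  | add p q hp hq =>
    simp only [Polynomial.map_add, _root_.map_add, LinearMap.add_apply, hp, hq]
  | monomial n a ih =>
    have h1 : ∀ (g : Module.End ℂ V) (b : ℂ),
        aeval g (C b * X ^ (n + 1)) = aeval g (C b * X ^ n) * g ∧
        aeval g (C b * X ^ (n + 1)) = g * aeval g (C b * X ^ n) := by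
      intro g b
      constructor
      · rw [pow_succ, ← mul_assoc, map_mul, aeval_X]
      · rw [pow_succ', mul_left_comm, map_mul, aeval_X]
    simp only [Polynomial.map_mul, Polynomial.map_C, Polynomial.map_pow, Polynomial.map_X] at ih ⊢
    rw [(h1 f a).1, (h1 f' _).2, Module.End.mul_apply, Module.End.mul_apply, ih, hf]

/-- A unitary gauge transformation in the stabilizer of a connection has a unitary square root in
the stabilizer, which is pointwise a fixed polynomial in the given transformation. -/
lemma exists_sqrt_stabilizer [ConnectedSpace M] {A : UnitaryConnection h} {u : unitaryGauge h}
    (hu : u • A = A) : ∃ (p : ℂ[X]) (v : unitaryGauge h), v • A = A ∧ v * v = u ∧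
      (∀ x, (v.1 x : E x →ₗ[ℂ] E x) = aeval (u.1 x : Module.End ℂ (E x)) p) ∧
      ∀ x, ((v.1 x).symm : E x →ₗ[ℂ] E x) =
        aeval ((u.1 x).symm : Module.End ℂ (E x)) (p.map (starRingEnd ℂ)) := by
  have hfd : ∀ x, FiniteDimensional ℂ (E x) := finiteDimensional_fiber (F := F)
  obtain ⟨x₀⟩ := (inferInstance : Nonempty M)
  obtain ⟨p, hp1, hp2⟩ := exists_polynomial_sqrt (h.conj_symm x₀) (h.pos x₀) (u.1 x₀) (u.2.2 x₀)
  have hu' : u⁻¹ • A = A := by rw [inv_smul_eq_iff, hu]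
  have hpar := isParallel_of_smul_eq hu
  have hpar' : A.IsParallel fun x => ((u.1 x).symm : E x →ₗ[ℂ] E x) := isParallel_of_smul_eq hu'
  have hadj : ∀ x e e', h.toFun x ((u.1 x : E x →ₗ[ℂ] E x) e) e' =
      h.toFun x e (((u.1 x).symm : E x →ₗ[ℂ] E x) e') := fun x e e' => by
    have := u.2.2 x e ((u.1 x).symm e')
    rw [LinearEquiv.apply_symm_apply] at this
    exact this
  have hadj' : ∀ x e e', h.toFun x (((u.1 x).symm : E x →ₗ[ℂ] E x) e) e' =
      h.toFun x e ((u.1 x : E x →ₗ[ℂ] E x) e') := fun x e e' => by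
    rw [← h.conj_symm, ← hadj, h.conj_symm]
  have hconj : (p.map (starRingEnd ℂ)).map (starRingEnd ℂ) = p := by
    rw [Polynomial.map_map]
    convert Polynomial.map_id using 2
    ext z
    simp
  -- `p(φ)² = φ` and `p̄(φ⁻¹) p(φ) = 1` hold at `x₀`, hence everywhere, both being equations between
  -- parallel endomorphisms
  have hsq : ∀ x, aeval (u.1 x : Module.End ℂ (E x)) (p ^ 2 - X) = 0 :=
    UnitaryConnection.IsParallel.eq_zero (hpar.aeval (p ^ 2 - X))
      (hpar'.aeval ((p ^ 2 - X).map (starRingEnd ℂ)))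
      (fun x => aeval_adjoint (hadj x) (p ^ 2 - X)) (x₀ := x₀)
      (by rw [_root_.map_sub, hp1, aeval_X, sub_self])
  have hone : ∀ x, aeval ((u.1 x).symm : Module.End ℂ (E x)) (p.map (starRingEnd ℂ)) *
      aeval (u.1 x : Module.End ℂ (E x)) p + algebraMap ℂ (Module.End ℂ (E x)) (-1) = 0 := by
    have h1 := ((hpar'.aeval (p.map (starRingEnd ℂ))).comp (hpar.aeval p)).add
      (UnitaryConnection.IsParallel.algebraMap (-1))
    refine UnitaryConnection.IsParallel.eq_zero h1 h1 (fun x e e' => ?_) (x₀ := x₀) ?_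
    · simp only [LinearMap.add_apply, Module.End.mul_apply, _root_.map_add,
        map_neg, map_one, LinearMap.neg_apply, Module.End.one_apply]
      rw [aeval_adjoint (hadj' x), hconj, aeval_adjoint (hadj x)]
    · rw [hp2, map_neg, map_one, add_neg_cancel]
  let f : ∀ x, Module.End ℂ (E x) := fun x => aeval (u.1 x : Module.End ℂ (E x)) p
  let f' : ∀ x, Module.End ℂ (E x) := fun x =>
    aeval ((u.1 x).symm : Module.End ℂ (E x)) (p.map (starRingEnd ℂ))
  have hf'f : ∀ x, f' x * f x = 1 := fun x => by
    have := hone x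
    rwa [map_neg, map_one, add_neg_eq_zero] at this
  have hff' : ∀ x, f x * f' x = 1 := fun x => mul_eq_one_comm.1 (hf'f x)
  let w : ∀ x, E x ≃ₗ[ℂ] E x := fun x => LinearEquiv.ofLinearMap (f x) (f' x) (hff' x) (hf'f x)
  have hw : w ∈ unitaryGauge h := by
    refine ⟨⟨(hpar.aeval p).smooth, (hpar'.aeval (p.map (starRingEnd ℂ))).smooth⟩,
      fun x e e' => ?_⟩
    change h.toFun x (f x e) (f x e') = _
    have h2 : f' x (f x e') = e' := congrArg (fun L : Module.End ℂ (E x) => L e') (hf'f x)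
    rw [aeval_adjoint (hadj x)]
    exact congrArg (h.toFun x e) h2
  refine ⟨p, ⟨w, hw⟩, smul_eq_of_isParallel (hpar.aeval p), ?_, fun x => rfl, fun x => rfl⟩
  ext x e
  have h1 := hsq x
  rw [_root_.map_sub, aeval_X, sub_eq_zero, sq, map_mul] at h1
  exact congrArg (fun L : Module.End ℂ (E x) => L e) h1

end Parallel

section Conjugation

open Polynomial

variable {M : Type*} [TopologicalSpace M] [T2Space M] [CompactSpace M] [ChartedSpace ℂ M]
  [IsManifold 𝓘(ℂ) ω M]
  {F : Type*} [NormedAddCommGroup F] [NormedSpace ℂ F] [FiniteDimensional ℂ F]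
  {E : M → Type*} [TopologicalSpace (TotalSpace F E)] [∀ x, TopologicalSpace (E x)]
  [FiberBundle F E] [∀ x, AddCommGroup (E x)] [∀ x, Module ℂ (E x)]
  [VectorBundle ℂ F E] [ContMDiffVectorBundle ∞ F E 𝓘(ℝ, ℂ)]
  {h : HermitianMetric F E} {σ : AntiholInvolution M} (τ : RealStructure F E σ)

/-! ### Conjugation by the real structure -/

lemma AntiholInvolution.tangent_surjective (σ : AntiholInvolution M) (x : M) :
    Function.Surjective (σ.tangent x) := by
  have hd : ∀ y, MDifferentiableAt 𝓘(ℝ, ℂ) 𝓘(ℝ, ℂ) σ.toFun y := fun y =>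
    (σ.smooth y).mdifferentiableAt (by simp)
  have h1 := mfderiv_comp x (hd (σ.toFun x)) (hd x)
  rw [σ.involutive.comp_self, mfderiv_id] at h1
  let L : ℂ →ₗ[ℝ] ℂ := (mfderiv 𝓘(ℝ, ℂ) 𝓘(ℝ, ℂ) σ.toFun x : ℂ →L[ℝ] ℂ).toLinearMap
  let L' : ℂ →ₗ[ℝ] ℂ := (mfderiv 𝓘(ℝ, ℂ) 𝓘(ℝ, ℂ) σ.toFun (σ.toFun x) : ℂ →L[ℝ] ℂ).toLinearMap
  have h2 : Function.LeftInverse L' L := fun v =>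
    (congrArg (fun K : ℂ →L[ℝ] ℂ => K v) h1).symm
  have h3 : Function.Surjective L := LinearMap.injective_iff_surjective.1 h2.injective
  exact h3

/-- `conjSec` is defined by a cast along `σ (σ x) = x`; equations in the total space describe it. -/
lemma cast_eq_of_mk_eq {x y : M} (hxy : y = x) {e : E y} {e' : E x}
    (he : TotalSpace.mk' F y e = TotalSpace.mk' F x e') : hxy ▸ e = e' := by
  subst hxy
  exact TotalSpace.mk_injective _ he

namespace RealStructure

lemma injective (x : M) : Function.Injective (τ.toFun x) := by
  intro e e' hee'
  have h1 := τ.involutive x e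
  rw [hee', τ.involutive x e'] at h1
  exact (TotalSpace.mk_injective _ h1).symm

lemma surjective (x : M) : Function.Surjective (τ.toFun x) := by
  have key : ∀ y, y = x → ∀ e : E y, ∃ e' : E x,
      TotalSpace.mk' F (σ.toFun y) (τ.toFun y e) = TotalSpace.mk' F (σ.toFun x) (τ.toFun x e') := by
    rintro _ rfl e
    exact ⟨e, rfl⟩
  intro e
  obtain ⟨e', he'⟩ := key _ (σ.involutive x) (τ.toFun (σ.toFun x) e)
  rw [τ.involutive] at he'
  exact ⟨e', (TotalSpace.mk_injective _ he').symm⟩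

/-- The real structure as an antilinear isomorphism from the fibre at `x` to that at `σ x`. -/
def fiberEquiv (x : M) : E x ≃ₛₗ[starRingEnd ℂ] E (σ.toFun x) :=
  LinearEquiv.ofBijective (τ.toFun x) ⟨τ.injective x, τ.surjective x⟩

lemma toFun_conjSec (s : Sec F E) (x : M) : τ.toFun x (τ.conjSec s x) = s (σ.toFun x) := by
  obtain ⟨e, he⟩ := τ.surjective x (s (σ.toFun x))
  rw [← he]
  congr 1
  refine cast_eq_of_mk_eq (F := F) (σ.involutive x) ?_
  rw [← he]
  exact τ.involutive x e

lemma conjSec_apply_toFun (s : Sec F E) (x : M) :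
    τ.conjSec s (σ.toFun x) = τ.toFun x (s x) := by
  refine τ.injective _ (TotalSpace.mk_injective (F := F) _ ?_)
  rw [τ.toFun_conjSec]
  exact (congrArg (fun y => TotalSpace.mk' F y (s y)) (σ.involutive x)).trans
    (τ.involutive x (s x)).symm

lemma conjSec_conjSec (s : Sec F E) : τ.conjSec (τ.conjSec s) = s := by
  ext x
  refine τ.injective x ?_
  rw [τ.toFun_conjSec, τ.conjSec_apply_toFun]

/-- The conjugate `τ⁻¹ u τ` of a fibrewise automorphism by the real structure. -/
def conjAut (u : ∀ x, E x ≃ₗ[ℂ] E x) (x : M) : E x ≃ₗ[ℂ] E x :=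
  ((τ.fiberEquiv x).trans (u (σ.toFun x))).trans (τ.fiberEquiv x).symm

lemma toFun_conjAut (u : ∀ x, E x ≃ₗ[ℂ] E x) (x : M) (e : E x) :
    τ.toFun x (τ.conjAut u x e) = u (σ.toFun x) (τ.toFun x e) :=
  (τ.fiberEquiv x).apply_symm_apply _

lemma conjAut_toFun (u : ∀ x, E x ≃ₗ[ℂ] E x) (x : M) (e : E x) :
    τ.conjAut u (σ.toFun x) (τ.toFun x e) = τ.toFun x (u x e) := by
  refine τ.injective _ (TotalSpace.mk_injective (F := F) _ ?_)
  rw [τ.toFun_conjAut]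
  refine Eq.trans ?_ (τ.involutive x (u x e)).symm
  exact congrArg (fun p : TotalSpace F E => TotalSpace.mk' F p.1 (u p.1 p.2)) (τ.involutive x e)

lemma conjAut_apply_sec {u : ∀ x, E x ≃ₗ[ℂ] E x}
    (hu : ∀ s : Sec F E, SmoothSec F fun x => u x (s x)) (s : Sec F E) (x : M) :
    τ.conjAut u x (s x) = τ.conjSec ⟨_, hu (τ.conjSec s)⟩ x := by
  refine τ.injective x ?_
  rw [τ.toFun_conjAut, τ.toFun_conjSec]
  exact congrArg (u (σ.toFun x)) (τ.conjSec_apply_toFun s x).symm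

lemma smooth_conjAut {u : ∀ x, E x ≃ₗ[ℂ] E x}
    (hu : ∀ s : Sec F E, SmoothSec F fun x => u x (s x)) (s : Sec F E) :
    SmoothSec F fun x => τ.conjAut u x (s x) := by
  have h1 : (fun x => TotalSpace.mk' F x (τ.conjAut u x (s x))) =
      fun x => TotalSpace.mk' F x (τ.conjSec ⟨_, hu (τ.conjSec s)⟩ x) := by
    funext x
    rw [τ.conjAut_apply_sec hu]
  rw [SmoothSec, h1]
  exact ContMDiffSection.contMDiff _

variable {τ} in
/-- The conjugate `τ⁻¹ u τ` of a unitary gauge transformation by a Hermitian real structure. -/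
def conjGauge (hτ : τ.IsHermitian h) (u : unitaryGauge h) : unitaryGauge h :=
  ⟨τ.conjAut u.1, ⟨τ.smooth_conjAut u.2.1.1, τ.smooth_conjAut (u := fun x => (u.1 x).symm) u.2.1.2⟩,
    fun x e e' => by
      apply (starRingEnd ℂ).injective
      rw [← hτ, τ.toFun_conjAut, τ.toFun_conjAut, u.2.2, hτ]⟩

variable {τ} in
lemma conjGauge_smul_eq (hτ : τ.IsHermitian h) {u : unitaryGauge h} {A A' : UnitaryConnection h}
    (hA : A.IsReal τ) (hA' : A'.IsReal τ) (hu : u • A' = A) : conjGauge hτ u • A' = A := by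
  ext s y w
  obtain ⟨x, rfl⟩ := σ.involutive.surjective y
  obtain ⟨v, rfl⟩ := σ.tangent_surjective x w
  have h1 : gaugeSec (toComplexGauge (conjGauge hτ u))⁻¹ s =
      τ.conjSec (gaugeSec (toComplexGauge u)⁻¹ (τ.conjSec s)) := by
    ext x
    exact τ.conjAut_apply_sec (u := fun x => (u.1 x).symm) u.2.1.2 s x
  change τ.conjAut u.1 (σ.toFun x) (A'.toFun (gaugeSec (toComplexGauge (conjGauge hτ u))⁻¹ s)
    (σ.toFun x) (σ.tangent x v)) = _
  rw [h1, hA', τ.conjAut_toFun]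
  change τ.toFun x ((u • A').toFun (τ.conjSec s) x v) = _
  rw [hu, ← hA, τ.conjSec_conjSec]

end RealStructure

/-! ### Real gauge orbits -/

/-- An antilinear map intertwining `f'` and `f` intertwines `p̄(f')` and `p(f)`. -/
lemma aeval_antilinear {V W : Type*} [AddCommGroup V] [Module ℂ V] [AddCommGroup W] [Module ℂ W]
    {T : V →ₗ⋆[ℂ] W} {f : Module.End ℂ W} {f' : Module.End ℂ V} (hf : ∀ e, f (T e) = T (f' e))
    (p : ℂ[X]) (e : V) : aeval f p (T e) = T (aeval f' (p.map (starRingEnd ℂ)) e) := by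
  induction p using Polynomial.induction_on generalizing e with
  | C a =>
    simp [Module.algebraMap_end_apply]
  | add p q hp hq =>
    simp only [Polynomial.map_add, _root_.map_add, LinearMap.add_apply, hp, hq]
  | monomial n a ih =>
    simp only [Polynomial.map_mul, Polynomial.map_C, Polynomial.map_pow, Polynomial.map_X] at ih ⊢
    rw [pow_succ, ← mul_assoc, ← mul_assoc, map_mul _ (C a * X ^ n), map_mul _ (_ * _) X, aeval_X,
      aeval_X, Module.End.mul_apply, Module.End.mul_apply, hf, ih]

variable {τ}

/-- Real connections in the same unitary gauge orbit lie in the same real gauge orbit. If `A = u A'`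
then `φ = u⁻¹ ū` stabilizes `A'` and satisfies `φ̄ = φ⁻¹`; a polynomial square root `v = p(φ)` then
satisfies `v̄ = v⁻¹`, so that `u v` is real. -/
theorem exists_real_gauge [ConnectedSpace M] (hτ : τ.IsHermitian h) {u : unitaryGauge h}
    {A A' : UnitaryConnection h} (hA : A.IsReal τ) (hA' : A'.IsReal τ) (hu : u • A' = A) :
    ∃ w ∈ realGauge h τ, w • A' = A := by
  set ubar := RealStructure.conjGauge hτ u
  have hφ : (u⁻¹ * ubar) • A' = A' := by
    rw [mul_smul, RealStructure.conjGauge_smul_eq hτ hA hA' hu, inv_smul_eq_iff, hu]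
  obtain ⟨p, v, hv, hvv, hvp, hvp'⟩ := exists_sqrt_stabilizer hφ
  have hφτ : ∀ x e, (u⁻¹ * ubar).1 (σ.toFun x) (τ.toFun x e) =
      τ.toFun x (((u⁻¹ * ubar).1 x).symm e) := by
    intro x e
    change (u.1 (σ.toFun x)).symm (τ.conjAut u.1 (σ.toFun x) (τ.toFun x e)) =
      τ.toFun x ((τ.conjAut u.1 x).symm (u.1 x e))
    rw [τ.conjAut_toFun, LinearEquiv.symm_apply_eq, ← τ.toFun_conjAut,
      LinearEquiv.apply_symm_apply]
  have hvτ : ∀ x e, v.1 (σ.toFun x) (τ.toFun x e) = τ.toFun x ((v.1 x).symm e) := by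
    intro x e
    have h1 := aeval_antilinear (T := τ.toFun x)
      (f := ((u⁻¹ * ubar).1 (σ.toFun x) : E (σ.toFun x) →ₗ[ℂ] E (σ.toFun x)))
      (f' := (((u⁻¹ * ubar).1 x).symm : E x →ₗ[ℂ] E x)) (hφτ x) p e
    rw [← hvp, ← hvp'] at h1
    exact h1
  refine ⟨u * v, fun x e => ?_, by rw [mul_smul, hv, hu]⟩
  -- `w τ = τ w` for `w = u v` amounts to `ū v⁻¹ = u v`, i.e. to `u v² = ū`
  have h2 : u * v * v = ubar := by rw [mul_assoc, hvv, mul_inv_cancel_left]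
  have h3 : τ.conjAut u.1 x ((v.1 x).symm e) = u.1 x (v.1 x e) := by
    have h4 : (u * v * v).1 x ((v.1 x).symm e) = ubar.1 x ((v.1 x).symm e) := by rw [h2]
    refine h4.symm.trans ?_
    change u.1 x (v.1 x (v.1 x ((v.1 x).symm e))) = _
    rw [LinearEquiv.apply_symm_apply]
  change u.1 (σ.toFun x) (v.1 (σ.toFun x) (τ.toFun x e)) = τ.toFun x (u.1 x (v.1 x e))
  rw [hvτ, ← τ.toFun_conjAut, h3]

end Conjugation

end RealYM

end

theorem mainTheorem3
    {M : Type*} [TopologicalSpace M] [T2Space M] [CompactSpace M] [ConnectedSpace M]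
    [ChartedSpace ℂ M] [IsManifold 𝓘(ℂ) ω M]
    (g : CompatibleMetric M) (hg : g.UnitVolume)
    (σ : AntiholInvolution M) (hσ : σ.IsIsometry g)
    {F : Type*} [NormedAddCommGroup F] [NormedSpace ℂ F] [FiniteDimensional ℂ F]
    {E : M → Type*} [TopologicalSpace (TotalSpace F E)] [∀ x, TopologicalSpace (E x)]
    [FiberBundle F E] [∀ x, AddCommGroup (E x)] [∀ x, Module ℂ (E x)]
    [VectorBundle ℂ F E] [ContMDiffVectorBundle ∞ F E 𝓘(ℝ, ℂ)]
    (hr : 1 ≤ Module.finrank ℂ F)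
    (h : HermitianMetric F E) (d : ℤ) (hd : HasDegree h d)
    (τ : RealStructure F E σ) (hτ : τ.IsHermitian h) :
    ∃ Φ : RealQuotient h g d τ → RealModuli h σ g d,
      (∀ A : RealYangMills h g d τ,
        (Φ (Quotient.mk (realOrbits h g d τ) A) : Moduli h g d) =
          Quotient.mk (unitaryOrbits h g d) A.1) ∧
      Function.Injective Φ := by
  refine ⟨Quotient.lift (fun A => ⟨Quotient.mk (unitaryOrbits h g d) A.1,
    mk_mem_realModuli hg hr A⟩) ?_, fun A => rfl, ?_⟩
  · rintro A B ⟨u, hu⟩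
    exact Subtype.ext (Quotient.sound ⟨u.1, hu⟩)
  · rintro ⟨A⟩ ⟨B⟩ hAB
    obtain ⟨u, hu⟩ := Quotient.exact (congrArg Subtype.val hAB)
    obtain ⟨w, hw, hwA⟩ := exists_real_gauge hτ A.2 B.2 hu
    exact Quotient.sound ⟨⟨w, hw⟩, hwA⟩
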